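/- For a Lebesgue measurable set $\Omega\subset\mathbb R^2$ with $|\Omega|<\infty$ and finite De Giorgi perimeter $P(\Omega)=\sup\{\int_\Omega \nabla\cdot\phi\,dx:\ \phi\in C^1_c(\mathbb R^2;\mathbb R^2),\ |\phi|\le 1\}<\infty$, let $\partial^*\Omega$ be its reduced boundary, $\nu$ its measure-theoretic outer unit normal, $B_1(y)$ the open unit disk centred at $y$, $H_-(y)=\{x:(x-y)\cdot\nu(y)<0\}$, and set $$E_{1,0}(\Omega)=-P(\Omega)+\frac12\int_{\partial^*\Omega}\int_{(\Omega\Delta H_-(y))\cap B_1(y)}\left|\nu(y)\cdot\frac{x-y}{|x-y|^3}\right|dx\,d\mathcal H^1(y)+\frac12\int_{\partial^*\Omega}\int_{\Omega\setminus B_1(y)}\nu(y)\cdot\frac{x-y}{|x-y|^3}\,dx\,d\mathcal H^1(y)\in\mathbb R\cup\{+\infty\}.$$ Suppose that, in addition, $\Omega$ has a $C^2$ boundary, and that $\partial\Omega$ is the disjoint union of finitely many closed $C^2$ Jordan curves $\gamma_i$, $1\le i\le N$, of lengths $P_i>0$, parametrized by arc length on $[0,P_i]$, extended $P_i$-periodically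 to $\mathbb R$ (with the extension of class $C^2$), and positively oriented with respect to $\Omega$, i.e. $\Omega$ lies to the left of each $\gamma_i$. Write $(a,b)^\perp=(-b,a)$. Then $$E_{1,0}(\Omega)=-\sum_{i=1}^N P_i\left[\log\left(\frac{P_i}{2}\right)+2\right]+\frac12\sum_{i=1}^N\int_0^{P_i}\int_{-P_i/2}^{P_i/2}\left(\frac1{|s|}-\frac{\dot\gamma_i^\perp(t+s)\cdot\dot\gamma_i^\perp(t)}{|\gamma_i(t+s)-\gamma_i(t)|}\right)ds\,dt-\sum_{i=1}^{N-1}\sum_{j=i+1}^N\int_0^{P_i}\int_0^{P_j}\frac{\dot\gamma_j^\perp(s)\cdot\dot\gamma_i^\perp(t)}{|\gamma_j(s)-\gamma_i(t)|}\,ds\,dt,$$ where all the double integrals on the right-hand side converge absolutely; in particular $E_{1,0}(\Omega)$ is finite. -/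

import Mathlib

open MeasureTheory Set Filter Topology
open scoped ENNReal

noncomputable section

namespace DipolarEnergy

/-- The Euclidean plane. -/
abbrev Plane : Type := EuclideanSpace ℝ (Fin 2)

/-- Counter-clockwise rotation by 90 degrees, `(a, b)^⊥ = (-b, a)`. -/
def perp (v : Plane) : Plane := !₂[-(v 1), v 0]

/-- The divergence of a vector field on the plane. -/
def divergence (φ : Plane → Plane) (x : Plane) : ℝ :=
  ∑ i : Fin 2, fderiv ℝ φ x (EuclideanSpace.single i 1) i

/-- Test vector fields of class `C¹_c(ℝ²; ℝ²)`. -/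
def IsTestField (φ : Plane → Plane) : Prop :=
  ContDiff ℝ 1 φ ∧ HasCompactSupport φ

/-- The perimeter in the sense of De Giorgi:
`P(Ω) = sup {∫_Ω div φ : φ ∈ C¹_c(ℝ²; ℝ²), |φ| ≤ 1}`.
(The field `φ = 0` is admissible, so truncating negative values of the integral at zero does
not change the supremum.) -/
def perimeter (Ω : Set Plane) : ℝ≥0∞ :=
  ⨆ (φ : Plane → Plane) (_ : IsTestField φ ∧ ∀ x, ‖φ x‖ ≤ 1),
    ENNReal.ofReal (∫ x in Ω, divergence φ x)

/-- `σ` and `n` are the polar decomposition of the Gauss-Green measure `μ_Ω = n σ` of `Ω`: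
`σ = |μ_Ω|` is a Radon measure (on the plane, a locally finite Borel measure), `n` is a Borel
field with `|n| = 1` `σ`-almost everywhere, and `∫_Ω div φ dx = ∫ φ · n dσ` for all test fields.
The measure `σ` is uniquely determined by `Ω`, and so is `n` up to `σ`-null sets. -/
structure IsGaussGreen (Ω : Set Plane) (σ : Measure Plane) (n : Plane → Plane) : Prop where
  locallyFinite : IsLocallyFiniteMeasure σ
  measurable : Measurable n
  norm_eq_one : ∀ᵐ x ∂σ, ‖n x‖ = 1
  gauss_green : ∀ φ : Plane → Plane, IsTestField φ →
    ∫ x in Ω, divergence φ x = ∫ x, inner ℝ (φ x) (n x) ∂σ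

/-- `v` is the (measure-theoretic) outer unit normal of `Ω` at `y` in the sense of De Giorgi:
`y` lies in the support of `|μ_Ω|`, the averages `μ_Ω(B_r(y)) / |μ_Ω|(B_r(y))` converge to `v`
as `r → 0`, and `|v| = 1`. -/
def HasOuterNormal (Ω : Set Plane) (y v : Plane) : Prop :=
  ‖v‖ = 1 ∧ ∃ (σ : Measure Plane) (n : Plane → Plane), IsGaussGreen Ω σ n ∧
    (∀ r : ℝ, 0 < r → 0 < σ (Metric.ball y r)) ∧
    Tendsto (fun r : ℝ => (σ.real (Metric.ball y r))⁻¹ • ∫ x in Metric.ball y r, n x ∂σ)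
      (𝓝[>] 0) (𝓝 v)

/-- The reduced boundary `∂*Ω`. -/
def reducedBoundary (Ω : Set Plane) : Set Plane := {y | ∃ v, HasOuterNormal Ω y v}

open Classical in
/-- The outer unit normal `ν` on the reduced boundary (and `0` elsewhere). -/
def outerNormal (Ω : Set Plane) (y : Plane) : Plane :=
  if h : ∃ v, HasOuterNormal Ω y v then h.choose else 0

/-- The open half-plane `H_-(y) = {x : (x - y) · ν(y) < 0}`. -/
def halfPlane (Ω : Set Plane) (y : Plane) : Set Plane :=
  {x | inner ℝ (x - y) (outerNormal Ω y) < 0}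

/-- The near-field term, a nonnegative integral with values in `[0, ∞]`:
`∫_{∂*Ω} ∫_{(Ω Δ H_-(y)) ∩ B_1(y)} |ν(y) · (x - y) / |x - y|³| dx dH¹(y)`. -/
def nearField (Ω : Set Plane) : ℝ≥0∞ :=
  ∫⁻ y in reducedBoundary Ω,
    (∫⁻ x in symmDiff Ω (halfPlane Ω y) ∩ Metric.ball y 1,
      ENNReal.ofReal |inner ℝ (outerNormal Ω y) (x - y) / ‖x - y‖ ^ 3| ∂volume)
    ∂(μH[1] : Measure Plane)

/-- The far-field term `∫_{∂*Ω} ∫_{Ω \ B_1(y)} ν(y) · (x - y) / |x - y|³ dx dH¹(y)`. The integrand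
is at most `1` in absolute value, since `|x - y| ≥ 1`, so the integral converges absolutely if `Ω` has finite area
and finite perimeter. -/
def farField (Ω : Set Plane) : ℝ :=
  ∫ y in reducedBoundary Ω,
    (∫ x in Ω \ Metric.ball y 1, inner ℝ (outerNormal Ω y) (x - y) / ‖x - y‖ ^ 3 ∂volume)
    ∂(μH[1] : Measure Plane)

/-- The critical limit energy
`E_{1,0}(Ω) = -P(Ω) + (1/2) nearField(Ω) + (1/2) farField(Ω) ∈ ℝ ∪ {+∞}`,
for sets `Ω` of finite area and finite perimeter. -/
def E10 (Ω : Set Plane) : EReal :=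
  -(perimeter Ω : EReal) + ((nearField Ω / 2 : ℝ≥0∞) : EReal) + ((farField Ω / 2 : ℝ) : EReal)

/-- `Ω` has a `C²` boundary: near every boundary point there is a `C²` function `ρ` without critical
points such that `Ω` is `{ρ < 0}` up to points of `{ρ = 0}`. -/
def HasC2Boundary (Ω : Set Plane) : Prop :=
  ∀ p ∈ frontier Ω, ∃ (U : Set Plane) (ρ : Plane → ℝ), IsOpen U ∧ p ∈ U ∧ ContDiffOn ℝ 2 ρ U ∧
    (∀ x ∈ U, fderiv ℝ ρ x ≠ 0) ∧ ∀ x ∈ U, (ρ x < 0 → x ∈ Ω) ∧ (0 < ρ x → x ∉ Ω)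

/-- `γ` is a closed `C²` Jordan curve of length `P` parametrized by arc length on `[0, P]`, and
extended periodically to the real line. -/
structure IsArcLengthJordanCurve (P : ℝ) (γ : ℝ → Plane) : Prop where
  length_pos : 0 < P
  contDiff : ContDiff ℝ 2 γ
  periodic : Function.Periodic γ P
  injOn : InjOn γ (Ico 0 P)
  arcLength : ∀ t, ‖deriv γ t‖ = 1

/-- `γ` is positively oriented as a boundary curve of `Ω`: the set `Ω` lies to the left of `γ`,
i.e. `γ'^⊥` points into `Ω`. (So outer boundary curves run counter-clockwise and the boundary
curves of holes run clockwise.) -/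
def IsPositivelyOriented (Ω : Set Plane) (γ : ℝ → Plane) : Prop :=
  ∀ t, ∀ᶠ ε : ℝ in 𝓝[>] 0, γ t + ε • perp (deriv γ t) ∈ Ω

/-- The regularized self-interaction density
`1/|s| - γ'^⊥(t+s) · γ'^⊥(t) / |γ(t+s) - γ(t)|`. -/
def selfDensity (γ : ℝ → Plane) (t s : ℝ) : ℝ :=
  1 / |s| - inner ℝ (perp (deriv γ (t + s))) (perp (deriv γ t)) / ‖γ (t + s) - γ t‖

/-- The mutual interaction density `η'^⊥(s) · γ'^⊥(t) / |η(s) - γ(t)|` of two curves. -/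
def mutualDensity (γ η : ℝ → Plane) (t s : ℝ) : ℝ :=
  inner ℝ (perp (deriv η s)) (perp (deriv γ t)) / ‖η s - γ t‖

end DipolarEnergy

end

noncomputable section

namespace DipolarEnergy

/-! ### The plane: rotation, orthonormal frames -/

/-! The dipole kernel is a divergence: `ν · (x - y) / |x - y|³` is minus the divergence in `x` of `ν
/ |x - y|`. Gauss-Green therefore turns its integral over `Ω` into the boundary integral of `-ν(z) ·
ν(y) / |z - y|`, except that this diverges logarithmically when `y` lies on the boundary. Everything
is done with `|v|` replaced by `√(|v|² + ε²)`, and `ε → 0` is taken after the divergences have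
cancelled.

The kernel is nonpositive on `H_-(y)` and nonnegative off it, so the absolute value over `Ω Δ
H_-(y)` is the signed integral over `Ω ∩ B_1(y)` minus that over the half disk
(`indicator_symmDiff_abs`). The half disk gives `2 / √(1 + ε²) - 2 arsinh(1/ε)`. The integral over
`Ω ∩ B_1(y)` is the one over `Ω` minus the far field, so the far field disappears from the energy.
The integral over `Ω` is a sum over curves (`IsBoundedBy.integral_softKernel`). The curve through
`y` contributes `-2 arsinh(P/(2ε))` plus the integral of a density bounded uniformly in `ε`, by the
cubic chord estimate `sub_cube_le_norm_sub` (`exists_softSelf_bound`, `integral_softSelf`). The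
difference of the two `arsinh` terms tends to `log(P/2)`. Monotone convergence in the near field and
dominated convergence elsewhere give the pointwise identity `lintegral_near`. Integrating it over
the boundary, halving, and subtracting the perimeter yields the formula, the factor `1/2` being
absorbed by counting each pair of curves once.

The geometric input is that, for this `Ω`, reduced boundary, normal and perimeter are the classical
ones. Gauss-Green is proved locally in the coordinates `(t, w) ↦ γ t + w τ^⊥` and patched by a
partition of unity (`gaussGreen`). Hence `H¹` on the frontier with a `C¹` extension of the normal is
a polar decomposition of the Gauss-Green measure. Such a decomposition is unique
(`IsGaussGreen.unique`), and continuity of the extension identifies the normal at every boundary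
point. -/

@[simp] lemma perp_apply_zero (v : Plane) : perp v 0 = -(v 1) := rfl

@[simp] lemma perp_apply_one (v : Plane) : perp v 1 = v 0 := rfl

lemma inner_eq_coords (v w : Plane) : inner ℝ v w = v 0 * w 0 + v 1 * w 1 := by
  simp [PiLp.inner_apply, Fin.sum_univ_two, mul_comm]

lemma norm_sq_eq_coords (v : Plane) : ‖v‖ ^ 2 = v 0 ^ 2 + v 1 ^ 2 := by
  rw [← real_inner_self_eq_norm_sq, inner_eq_coords]; ring

lemma plane_ext {v w : Plane} (h0 : v 0 = w 0) (h1 : v 1 = w 1) : v = w := by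
  ext i; fin_cases i
  · exact h0
  · exact h1

@[simp] lemma inner_perp_perp (v w : Plane) : inner ℝ (perp v) (perp w) = inner ℝ v w := by
  simp [inner_eq_coords]; ring

@[simp] lemma inner_self_perp (v : Plane) : inner ℝ v (perp v) = 0 := by
  simp [inner_eq_coords]; ring

@[simp] lemma inner_perp_self (v : Plane) : inner ℝ (perp v) v = 0 := by
  simp [inner_eq_coords]; ring

@[simp] lemma norm_perp (v : Plane) : ‖perp v‖ = ‖v‖ := by
  have : ‖perp v‖ ^ 2 = ‖v‖ ^ 2 := by
    rw [← real_inner_self_eq_norm_sq, inner_perp_perp, real_inner_self_eq_norm_sq]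
  exact (pow_left_inj₀ (norm_nonneg _) (norm_nonneg _) two_ne_zero).1 this

lemma perp_add (v w : Plane) : perp (v + w) = perp v + perp w := by
  refine plane_ext ?_ ?_ <;> simp; ring

lemma perp_smul (c : ℝ) (v : Plane) : perp (c • v) = c • perp v := by
  refine plane_ext ?_ ?_ <;> simp

lemma perp_perp (v : Plane) : perp (perp v) = -v := by
  refine plane_ext ?_ ?_ <;> simp

/-- The rotation `perp` as a continuous linear map. -/
def perpL : Plane →L[ℝ] Plane :=
  LinearMap.toContinuousLinearMap
    { toFun := perp
      map_add' := perp_add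
      map_smul' := perp_smul }

@[fun_prop] lemma continuous_perp : Continuous perp := perpL.continuous

lemma contDiff_perp {n : WithTop ℕ∞} : ContDiff ℝ n perp := perpL.contDiff

lemma frame_decomp {τ : Plane} (hτ : ‖τ‖ = 1) (v : Plane) :
    v = (inner ℝ v τ) • τ + (inner ℝ v (perp τ)) • perp τ := by
  have h : τ 0 ^ 2 + τ 1 ^ 2 = 1 := by rw [← norm_sq_eq_coords, hτ]; norm_num
  refine plane_ext ?_ ?_
  · simp [inner_eq_coords]; linear_combination (-(v 0)) * h
  · simp [inner_eq_coords]; linear_combination (-(v 1)) * h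

lemma perp_frame_decomp {τ : Plane} (hτ : ‖τ‖ = 1) (v : Plane) :
    perp v = (inner ℝ v τ) • perp τ - (inner ℝ v (perp τ)) • τ := by
  conv_lhs => rw [frame_decomp hτ v]
  rw [perp_add, perp_smul, perp_smul, perp_perp, smul_neg, sub_eq_add_neg]

lemma linear_apply_coords (L : Plane →L[ℝ] Plane) (v : Plane) :
    L v = v 0 • L (EuclideanSpace.single 0 1) + v 1 • L (EuclideanSpace.single 1 1) := by
  conv_lhs => rw [show v = v 0 • EuclideanSpace.single 0 1 + v 1 • EuclideanSpace.single 1 1 from by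
    refine plane_ext ?_ ?_ <;> simp]
  simp

/-- The divergence is a trace, so it may be computed in any orthonormal frame. -/
lemma divergence_eq_frame {τ : Plane} (hτ : ‖τ‖ = 1) (φ : Plane → Plane) (x : Plane) :
    divergence φ x = inner ℝ (fderiv ℝ φ x τ) τ + inner ℝ (fderiv ℝ φ x (perp τ)) (perp τ) := by
  have h : τ 0 ^ 2 + τ 1 ^ 2 = 1 := by rw [← norm_sq_eq_coords, hτ]; norm_num
  rw [linear_apply_coords _ τ, linear_apply_coords _ (perp τ)]
  simp only [divergence, Fin.sum_univ_two, inner_eq_coords, perp_apply_zero, perp_apply_one,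
    PiLp.add_apply, PiLp.smul_apply, smul_eq_mul]
  linear_combination (-(fderiv ℝ φ x (EuclideanSpace.single 0 1) 0)
    - (fderiv ℝ φ x (EuclideanSpace.single 1 1) 1)) * h

/-- The linear isometry with matrix columns `τ` and `perp τ`. -/
def frameIsometry (τ : Plane) (hτ : ‖τ‖ = 1) : Plane →ₗᵢ[ℝ] Plane where
  toFun x := x 0 • τ + x 1 • perp τ
  map_add' x y := by simp [add_smul]; abel
  map_smul' c x := by simp [mul_smul]
  norm_map' x := by
    have h : τ 0 ^ 2 + τ 1 ^ 2 = 1 := by rw [← norm_sq_eq_coords, hτ]; norm_num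
    refine (pow_left_inj₀ (norm_nonneg _) (norm_nonneg _) two_ne_zero).1 ?_
    rw [norm_sq_eq_coords, norm_sq_eq_coords]
    simp
    linear_combination (x 0 ^ 2 + x 1 ^ 2) * h

/-- The parametrization `(u, w) ↦ u τ + w τ^⊥` of the plane. -/
def frame (τ : Plane) (p : ℝ × ℝ) : Plane := p.1 • τ + p.2 • perp τ

/-- `frame τ` as a measurable equivalence. -/
def frameEquiv (τ : Plane) (hτ : ‖τ‖ = 1) : ℝ × ℝ ≃ᵐ Plane :=
  (MeasurableEquiv.finTwoArrow.symm.trans (MeasurableEquiv.toLp 2 (Fin 2 → ℝ))).trans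
    ((frameIsometry τ hτ).toLinearIsometryEquiv rfl).toMeasurableEquiv

lemma coe_frameEquiv {τ : Plane} (hτ : ‖τ‖ = 1) : ⇑(frameEquiv τ hτ) = frame τ := by
  ext p : 1
  rfl

lemma measurableEmbedding_frame {τ : Plane} (hτ : ‖τ‖ = 1) : MeasurableEmbedding (frame τ) :=
  coe_frameEquiv hτ ▸ (frameEquiv τ hτ).measurableEmbedding

lemma measurePreserving_frame {τ : Plane} (hτ : ‖τ‖ = 1) :
    MeasurePreserving (frame τ) := by
  rw [← coe_frameEquiv hτ]
  exact ((LinearIsometryEquiv.measurePreserving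
    ((frameIsometry τ hτ).toLinearIsometryEquiv rfl)).comp
      (PiLp.volume_preserving_toLp (Fin 2))).comp (volume_preserving_finTwoArrow ℝ).symm

/-- Fubini's theorem in an orthonormal frame. -/
lemma integral_frame {τ : Plane} (hτ : ‖τ‖ = 1) {F : Plane → ℝ} (hF : Integrable F) :
    ∫ x, F x = ∫ u : ℝ, ∫ w : ℝ, F (u • τ + w • perp τ) := by
  rw [← (measurePreserving_frame hτ).integral_comp (measurableEmbedding_frame hτ)]
  exact integral_prod _ (((measurePreserving_frame hτ).integrable_comp_emb
    (measurableEmbedding_frame hτ)).2 hF)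

/-- `IsTestField` is stable under multiplication by a `C¹` function. -/
lemma IsTestField.smul {φ : Plane → Plane} (hφ : IsTestField φ) {χ : Plane → ℝ}
    (hχ : ContDiff ℝ 1 χ) : IsTestField (fun x => χ x • φ x) :=
  ⟨hχ.smul hφ.1, hφ.2.mono fun x hx h => hx (by simp [h])⟩

/-! ### Test fields and their divergence -/

lemma continuous_divergence {φ : Plane → Plane} (hφ : ContDiff ℝ 1 φ) :
    Continuous (divergence φ) := by
  have h := hφ.continuous_fderiv one_ne_zero
  unfold divergence
  refine continuous_finsetSum _ fun i _ => ?_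
  exact (EuclideanSpace.proj (𝕜 := ℝ) i).continuous.comp (h.clm_apply continuous_const)

lemma hasCompactSupport_divergence {φ : Plane → Plane} (hφ : IsTestField φ) :
    HasCompactSupport (divergence φ) := by
  refine (hφ.2.fderiv ℝ).mono ?_
  intro x hx
  contrapose! hx
  simp only [Function.mem_support, not_not] at hx ⊢
  simp [divergence, hx]

lemma integrable_divergence {φ : Plane → Plane} (hφ : IsTestField φ) :
    Integrable (divergence φ) :=
  (continuous_divergence hφ.1).integrable_of_hasCompactSupport (hasCompactSupport_divergence hφ)

lemma divergence_eq_zero_of_notMem_tsupport {φ : Plane → Plane} {x : Plane}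
    (hx : x ∉ tsupport φ) : divergence φ x = 0 := by
  simp [divergence, fderiv_of_notMem_tsupport ℝ hx]

lemma divergence_add {φ ψ : Plane → Plane} {x : Plane} (hφ : DifferentiableAt ℝ φ x)
    (hψ : DifferentiableAt ℝ ψ x) :
    divergence (fun y => φ y + ψ y) x = divergence φ x + divergence ψ x := by
  simp [divergence, fderiv_fun_add hφ hψ]; ring

/-! ### Closed curves parametrized by arc length -/

namespace IsArcLengthJordanCurve

variable {P : ℝ} {γ : ℝ → Plane}

lemma continuous (h : IsArcLengthJordanCurve P γ) : Continuous γ := h.contDiff.continuous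

lemma hasDerivAt (h : IsArcLengthJordanCurve P γ) (t : ℝ) : HasDerivAt γ (deriv γ t) t :=
  (h.contDiff.differentiable two_ne_zero t).hasDerivAt

lemma contDiff_deriv (h : IsArcLengthJordanCurve P γ) : ContDiff ℝ 1 (deriv γ) :=
  (contDiff_succ_iff_deriv (n := 1).1 (by simpa [one_add_one_eq_two] using h.contDiff)).2.2

lemma continuous_deriv (h : IsArcLengthJordanCurve P γ) : Continuous (deriv γ) :=
  h.contDiff_deriv.continuous

lemma periodic_deriv (h : IsArcLengthJordanCurve P γ) : Function.Periodic (deriv γ) P := by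
  intro t
  rw [← deriv_comp_add_const, show (fun x => γ (x + P)) = γ from funext h.periodic]

lemma norm_sub_le (h : IsArcLengthJordanCurve P γ) (t s : ℝ) : ‖γ t - γ s‖ ≤ |t - s| := by
  have := convex_univ.norm_image_sub_le_of_norm_deriv_le (f := γ) (C := 1) (x := s) (y := t)
    (fun x _ => (h.hasDerivAt x).differentiableAt) (fun x _ => (h.arcLength x).le) trivial trivial
  simpa using this

lemma lipschitzWith (h : IsArcLengthJordanCurve P γ) : LipschitzWith 1 γ :=
  LipschitzWith.of_dist_le_mul fun x y => by
    simpa [dist_eq_norm] using h.norm_sub_le x y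

/-- The velocity is Lipschitz continuous. -/
lemma exists_curvature_bound (h : IsArcLengthJordanCurve P γ) :
    ∃ K : ℝ, 0 ≤ K ∧ ∀ t s, ‖deriv γ t - deriv γ s‖ ≤ K * |t - s| := by
  have hc : Continuous (deriv (deriv γ)) := h.contDiff_deriv.continuous_deriv le_rfl
  have hper : Function.Periodic (deriv (deriv γ)) P := by
    intro t
    rw [← deriv_comp_add_const, show (fun x => deriv γ (x + P)) = deriv γ from
      funext h.periodic_deriv]
  obtain ⟨K, hK⟩ := (isCompact_Icc (a := (0 : ℝ)) (b := P)).exists_bound_of_continuousOn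
    hc.continuousOn
  have hK' : ∀ t, ‖deriv (deriv γ) t‖ ≤ K := by
    intro t
    obtain ⟨y, hy, hyt⟩ := hper.exists_mem_Ico₀ h.length_pos t
    rw [hyt]; exact hK y (Ico_subset_Icc_self hy)
  refine ⟨K, (norm_nonneg _).trans (hK' 0), fun t s => ?_⟩
  exact convex_univ.norm_image_sub_le_of_norm_deriv_le (f := deriv γ)
    (fun x _ => (h.contDiff_deriv.differentiable one_ne_zero) x) (fun x _ => hK' x) trivial trivial

lemma one_sub_inner (h : IsArcLengthJordanCurve P γ) (t s : ℝ) :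
    1 - inner ℝ (deriv γ t) (deriv γ s) = ‖deriv γ t - deriv γ s‖ ^ 2 / 2 := by
  rw [norm_sub_sq_real, h.arcLength, h.arcLength]; ring

lemma one_sub_inner_le (h : IsArcLengthJordanCurve P γ) {K : ℝ}
    (hK : ∀ t s, ‖deriv γ t - deriv γ s‖ ≤ K * |t - s|) (t s : ℝ) :
    1 - inner ℝ (deriv γ t) (deriv γ s) ≤ K ^ 2 * |t - s| ^ 2 / 2 := by
  rw [h.one_sub_inner, ← mul_pow]
  gcongr
  exact hK t s

/-- The chord is at least as long as its projection onto `γ'(s)`. That projection has speed `γ'(r) ·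
γ'(s)`, which falls short of `1` by `|γ'(r) - γ'(s)|² / 2`, a quadratic quantity. Integration makes
the deficit cubic, the order needed to keep the self-interaction bounded. -/
lemma sub_cube_le_norm_sub (h : IsArcLengthJordanCurve P γ) {K : ℝ}
    (hK : ∀ t s, ‖deriv γ t - deriv γ s‖ ≤ K * |t - s|) (t s : ℝ) :
    |t - s| - K ^ 2 * |t - s| ^ 3 / 2 ≤ ‖γ t - γ s‖ := by
  set f : ℝ → ℝ := fun r => inner ℝ (γ r - γ s) (deriv γ s) - (r - s) with hf
  have hd : ∀ r, HasDerivAt f (inner ℝ (deriv γ r) (deriv γ s) - 1) r := by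
    intro r
    have h1 := ((h.hasDerivAt r).sub_const (γ s)).inner ℝ (hasDerivAt_const r (deriv γ s))
    have h2 := h1.sub ((hasDerivAt_id r).sub_const s)
    simp only [inner_zero_right, zero_add] at h2
    exact h2
  have hb : ‖f t - f s‖ ≤ K ^ 2 * |t - s| ^ 2 / 2 * ‖t - s‖ := by
    refine (convex_uIcc s t).norm_image_sub_le_of_norm_hasDerivWithin_le
      (fun r _ => (hd r).hasDerivWithinAt) (fun r hr => ?_) left_mem_uIcc right_mem_uIcc
    rw [Real.norm_eq_abs, abs_sub_comm, abs_of_nonneg (by rw [h.one_sub_inner]; positivity)]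
    refine (h.one_sub_inner_le hK r s).trans ?_
    have : |r - s| ≤ |t - s| := abs_sub_left_of_mem_uIcc hr
    gcongr
  have h2 : |inner ℝ (γ t - γ s) (deriv γ s) - (t - s)| ≤ K ^ 2 * |t - s| ^ 3 / 2 := by
    have : f t - f s = inner ℝ (γ t - γ s) (deriv γ s) - (t - s) := by simp [hf]
    rw [← this, ← Real.norm_eq_abs]
    refine hb.trans (le_of_eq ?_)
    rw [Real.norm_eq_abs]; ring
  have h3 : |inner ℝ (γ t - γ s) (deriv γ s)| ≤ ‖γ t - γ s‖ := by
    simpa [h.arcLength] using abs_real_inner_le_norm (γ t - γ s) (deriv γ s)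
  have h4 := abs_sub_abs_le_abs_sub (t - s) (inner ℝ (γ t - γ s) (deriv γ s))
  rw [abs_sub_comm] at h2
  linarith

lemma eq_of_apply_eq (h : IsArcLengthJordanCurve P γ) {t s : ℝ} (hts : |t - s| < P)
    (he : γ t = γ s) : t = s := by
  have hP := h.length_pos
  wlog hle : s ≤ t generalizing t s
  · exact (this (by rwa [abs_sub_comm]) he.symm (le_of_not_ge hle)).symm
  rw [abs_of_nonneg (sub_nonneg.2 hle)] at hts
  set n := toIcoDiv hP 0 s
  have hper : ∀ x, γ (x - n • P) = γ x := fun x => h.periodic.sub_zsmul_eq n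
  have hs : s - n • P ∈ Ico 0 P := by
    have := sub_toIcoDiv_zsmul_mem_Ico hP 0 s
    rwa [zero_add] at this
  rcases lt_or_ge (t - n • P) P with h1 | h1
  · have := h.injOn (x₁ := t - n • P) (x₂ := s - n • P)
      ⟨by linarith [hs.1], h1⟩ hs (by rw [hper, hper, he])
    linarith
  · have := h.injOn (x₁ := t - n • P - P) (x₂ := s - n • P)
      ⟨by linarith, by linarith [hs.2]⟩ hs (by rw [h.periodic.sub_eq, hper, hper, he])
    linarith

lemma range_eq_image_Icc (h : IsArcLengthJordanCurve P γ) : range γ = γ '' Icc 0 P := by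
  refine Subset.antisymm ?_ (image_subset_range _ _)
  rintro _ ⟨t, rfl⟩
  obtain ⟨y, hy, hyt⟩ := h.periodic.exists_mem_Ico₀ h.length_pos t
  exact ⟨y, Ico_subset_Icc_self hy, hyt.symm⟩

lemma range_eq_image_Ico (h : IsArcLengthJordanCurve P γ) : range γ = γ '' Ico 0 P := by
  refine Subset.antisymm ?_ (image_subset_range _ _)
  rintro _ ⟨t, rfl⟩
  obtain ⟨y, hy, hyt⟩ := h.periodic.exists_mem_Ico₀ h.length_pos t
  exact ⟨y, hy, hyt.symm⟩

lemma isCompact_range (h : IsArcLengthJordanCurve P γ) : IsCompact (range γ) := by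
  rw [h.range_eq_image_Icc]; exact isCompact_Icc.image h.continuous

/-- The chord-arc condition. -/
lemma exists_chord_arc (h : IsArcLengthJordanCurve P γ) :
    ∃ c : ℝ, 0 < c ∧ ∀ t s, |s| ≤ P / 2 → c * |s| ≤ ‖γ (t + s) - γ t‖ := by
  have hP := h.length_pos
  obtain ⟨K, hK0, hK⟩ := h.exists_curvature_bound
  -- With `K δ ≤ 1` the cubic deficit is at most `|s| / 2` for `|s| ≤ δ`.
  set δ : ℝ := 1 / (K + 1)
  have hδ : 0 < δ := by positivity
  have hKδ : K * δ ≤ 1 := by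
    rw [mul_one_div, div_le_one (by positivity)]; linarith
  have hnear : ∀ t s, |s| ≤ δ → (1 / 2) * |s| ≤ ‖γ (t + s) - γ t‖ := by
    intro t s hs
    have h1 := h.sub_cube_le_norm_sub hK (t + s) t
    rw [add_sub_cancel_left] at h1
    have h2 : (K * |s|) ^ 2 ≤ 1 := by
      have : K * |s| ≤ 1 := (mul_le_mul_of_nonneg_left hs hK0).trans hKδ
      exact pow_le_one₀ (by positivity) this
    nlinarith [abs_nonneg s]
  -- For `δ ≤ |s| ≤ P / 2` the chord never vanishes, so compactness gives a positive lower bound.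
  -- Periodicity reduces `t` to one period.
  set S : Set (ℝ × ℝ) := Icc 0 P ×ˢ (Icc (-(P / 2)) (P / 2) ∩ {s | δ ≤ |s|})
  have hS : IsCompact S := isCompact_Icc.prod
    (isCompact_Icc.inter_right (isClosed_le continuous_const continuous_abs))
  have hcont : Continuous fun p : ℝ × ℝ => ‖γ (p.1 + p.2) - γ p.1‖ := by
    have := h.continuous; fun_prop
  have hfar : ∃ m : ℝ, 0 < m ∧ ∀ p ∈ S, m ≤ ‖γ (p.1 + p.2) - γ p.1‖ := by
    rcases S.eq_empty_or_nonempty with he | hne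
    · exact ⟨1, one_pos, by simp [he]⟩
    · obtain ⟨p, hp, hmin⟩ := hS.exists_isMinOn hne hcont.continuousOn
      refine ⟨_, ?_, fun q hq => hmin hq⟩
      rw [norm_pos_iff, sub_ne_zero]
      intro he
      have h1 : |p.2| ≤ P / 2 := abs_le.2 hp.2.1
      have := h.eq_of_apply_eq (by rw [add_sub_cancel_left]; linarith) he
      have h2 : p.2 = 0 := by linarith
      have h3 : δ ≤ |p.2| := hp.2.2
      rw [h2, abs_zero] at h3; linarith
  obtain ⟨m, hm, hmS⟩ := hfar
  refine ⟨min (1 / 2) (m / P), by positivity, fun t s hs => ?_⟩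
  rcases le_total |s| δ with h1 | h1
  · exact (mul_le_mul_of_nonneg_right (min_le_left _ _) (abs_nonneg _)).trans (hnear t s h1)
  · have hperΓ : Function.Periodic (fun t => ‖γ (t + s) - γ t‖) P := fun t => by
      simp only [h.periodic t]
      rw [show t + P + s = t + s + P by ring, h.periodic]
    obtain ⟨y, hy, hyt⟩ := hperΓ.exists_mem_Ico₀ hP t
    rw [hyt]
    refine le_trans ?_ (hmS (y, s) ⟨Ico_subset_Icc_self hy, abs_le.1 hs, h1⟩)
    refine (mul_le_mul_of_nonneg_right (min_le_right _ _) (abs_nonneg _)).trans ?_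
    rw [div_mul_eq_mul_div, div_le_iff₀ hP]
    nlinarith

end IsArcLengthJordanCurve

/-! ### Hausdorff measure on a curve -/

/-- The inverse of `γ` on the image of `A` is Lipschitz with constant `c⁻¹`, and Lipschitz maps
increase `H¹` at most by their constant. -/
lemma ofReal_mul_volume_le_hausdorffMeasure_image {γ : ℝ → Plane} {c : ℝ} (hc : 0 < c) {A : Set ℝ}
    (hA : ∀ x ∈ A, ∀ y ∈ A, c * |x - y| ≤ ‖γ x - γ y‖) :
    ENNReal.ofReal c * volume A ≤ μH[1] (γ '' A) := by
  have hinj : InjOn γ A := by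
    intro x hx y hy hxy
    have h1 := hA x hx y hy
    rw [hxy, sub_self, norm_zero] at h1
    have : |x - y| = 0 := le_antisymm (by nlinarith [abs_nonneg (x - y)]) (abs_nonneg _)
    exact sub_eq_zero.1 (abs_eq_zero.1 this)
  have hlip : LipschitzOnWith (Real.toNNReal c⁻¹) (Function.invFunOn γ A) (γ '' A) := by
    refine LipschitzOnWith.of_dist_le_mul ?_
    rintro _ ⟨x, hx, rfl⟩ _ ⟨y, hy, rfl⟩
    rw [hinj.leftInvOn_invFunOn hx, hinj.leftInvOn_invFunOn hy, Real.coe_toNNReal _ (by positivity),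
      dist_eq_norm, dist_eq_norm, Real.norm_eq_abs, inv_mul_eq_div, le_div_iff₀ hc, mul_comm]
    exact hA x hx y hy
  have h1 := hlip.hausdorffMeasure_image_le zero_le_one (d := 1)
  rw [hinj.invFunOn_image subset_rfl, hausdorffMeasure_real, ENNReal.rpow_one] at h1
  calc ENNReal.ofReal c * volume A
      ≤ ENNReal.ofReal c * (ENNReal.ofReal c⁻¹ * μH[1] (γ '' A)) := by gcongr; exact h1
    _ = μH[1] (γ '' A) := by
      rw [← mul_assoc, ← ENNReal.ofReal_mul hc.le, mul_inv_cancel₀ hc.ne', ENNReal.ofReal_one,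
        one_mul]

namespace IsArcLengthJordanCurve

variable {P : ℝ} {γ : ℝ → Plane}

/-- One inequality holds because `γ` is 1-Lipschitz. For the other, fix `c < 1`: on pieces of small
length `δ` the chord is at least `c` times the arc, and the images of the pieces are disjoint, so
the local bounds add up. Then `c → 1`. -/
lemma hausdorffMeasure_image (h : IsArcLengthJordanCurve P γ) {A : Set ℝ} (hA : MeasurableSet A)
    (hAP : A ⊆ Ico 0 P) : μH[1] (γ '' A) = volume A := by
  refine le_antisymm ?_ ?_
  · simpa [hausdorffMeasure_real] using
      h.lipschitzWith.hausdorffMeasure_image_le zero_le_one A (d := 1)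
  obtain ⟨K, hK0, hK⟩ := h.exists_curvature_bound
  have key : ∀ c ∈ Ioo (0 : ℝ) 1, ENNReal.ofReal c * volume A ≤ μH[1] (γ '' A) := by
    rintro c ⟨hc0, hc1⟩
    obtain ⟨δ, hδ, hKδ⟩ : ∃ δ : ℝ, 0 < δ ∧ K ^ 2 * δ ^ 2 / 2 ≤ 1 - c := by
      have : Tendsto (fun δ : ℝ => K ^ 2 * δ ^ 2 / 2) (𝓝[>] 0) (𝓝 0) := by
        have h0 : Continuous fun δ : ℝ => K ^ 2 * δ ^ 2 / 2 := by fun_prop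
        simpa using (h0.tendsto 0).mono_left nhdsWithin_le_nhds
      obtain ⟨δ, h1, h2⟩ := ((this.eventually (ge_mem_nhds (sub_pos.2 hc1))).and
        self_mem_nhdsWithin).exists
      exact ⟨δ, h2, h1⟩
    set I : ℤ → Set ℝ := fun n => A ∩ Ico (n • δ) ((n + 1) • δ) with hI
    have hIm : ∀ n, MeasurableSet (I n) := fun n => hA.inter measurableSet_Ico
    have hId : Pairwise (Function.onFun Disjoint I) := fun m n hmn =>
      (pairwise_disjoint_Ico_zsmul δ hmn).mono inter_subset_right inter_subset_right
    have hIU : ⋃ n, I n = A := by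
      rw [← inter_iUnion, iUnion_Ico_zsmul hδ, inter_univ]
    have hIs : ∀ n, I n ⊆ Ico 0 P := fun n => inter_subset_left.trans hAP
    have him : ∀ n, MeasurableSet (γ '' I n) := fun n =>
      (hIm n).image_of_continuousOn_injOn h.continuous.continuousOn (h.injOn.mono (hIs n))
    have hid : Pairwise (Function.onFun Disjoint fun n => γ '' I n) := fun m n hmn =>
      disjoint_image_image fun x hx y hy hxy =>
        disjoint_left.1 (hId hmn) hx (h.injOn (hIs m hx) (hIs n hy) hxy ▸ hy)
    have hle : ∀ n, ENNReal.ofReal c * volume (I n) ≤ μH[1] (γ '' I n) := by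
      intro n
      refine ofReal_mul_volume_le_hausdorffMeasure_image hc0 fun x hx y hy => ?_
      refine le_trans ?_ (h.sub_cube_le_norm_sub hK x y)
      have hxy : |x - y| ≤ δ := by
        have h1 := hx.2; have h2 := hy.2
        simp only [add_smul, one_smul, mem_Ico] at h1 h2
        rw [abs_le]; constructor <;> linarith
      have h3 : K ^ 2 * |x - y| ^ 2 / 2 ≤ 1 - c := le_trans (by gcongr) hKδ
      nlinarith [abs_nonneg (x - y)]
    calc ENNReal.ofReal c * volume A = ∑' n, ENNReal.ofReal c * volume (I n) := by
          rw [ENNReal.tsum_mul_left, ← measure_iUnion hId hIm, hIU]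
      _ ≤ ∑' n, μH[1] (γ '' I n) := ENNReal.tsum_le_tsum hle
      _ = μH[1] (γ '' A) := by rw [← measure_iUnion hid him, ← image_iUnion, hIU]
  have hlim : Tendsto (fun c : ℝ => ENNReal.ofReal c * volume A) (𝓝[<] 1)
      (𝓝 (ENNReal.ofReal 1 * volume A)) := by
    refine ENNReal.Tendsto.mul_const ?_ (Or.inl (by simp))
    exact (ENNReal.continuous_ofReal.tendsto 1).mono_left nhdsWithin_le_nhds
  have := le_of_tendsto hlim (Filter.mem_of_superset (Ioo_mem_nhdsLT zero_lt_one) key)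
  simpa using this

/-- Arc length: the one-dimensional Hausdorff measure on the curve is the image of Lebesgue
measure. -/
lemma restrict_hausdorffMeasure (h : IsArcLengthJordanCurve P γ) :
    (μH[1] : Measure Plane).restrict (range γ) = (volume.restrict (Ico 0 P)).map γ := by
  ext B hB
  rw [Measure.restrict_apply hB, Measure.map_apply h.continuous.measurable hB,
    Measure.restrict_apply (h.continuous.measurable hB),
    ← h.hausdorffMeasure_image ((h.continuous.measurable hB).inter measurableSet_Ico)
      inter_subset_right, h.range_eq_image_Ico, image_preimage_inter]

/-- Since `γ` on `[0, P)` is a measurable embedding, no measurability of `f` is needed. This matters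
for the near field, whose inner integral is not known to be measurable in `y` beforehand. -/
lemma lintegral_map (h : IsArcLengthJordanCurve P γ) (f : Plane → ℝ≥0∞) :
    ∫⁻ y, f y ∂((volume.restrict (Ico 0 P)).map γ) = ∫⁻ t in Ico 0 P, f (γ t) := by
  have he := h.continuous.continuousOn.measurableEmbedding measurableSet_Ico h.injOn
  rw [← map_comap_subtype_coe measurableSet_Ico,
    Measure.map_map h.continuous.measurable measurable_subtype_coe]
  change ∫⁻ y, f y ∂(Measure.map ((Ico 0 P).domRestrict γ) _) = _
  rw [he.lintegral_map, (MeasurableEmbedding.subtype_coe measurableSet_Ico).lintegral_map]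
  rfl

lemma integral_map (h : IsArcLengthJordanCurve P γ) {F : Type*} [NormedAddCommGroup F]
    [NormedSpace ℝ F] (f : Plane → F) :
    ∫ y, f y ∂((volume.restrict (Ico 0 P)).map γ) = ∫ t in Ico 0 P, f (γ t) := by
  have he := h.continuous.continuousOn.measurableEmbedding measurableSet_Ico h.injOn
  rw [← map_comap_subtype_coe measurableSet_Ico,
    Measure.map_map h.continuous.measurable measurable_subtype_coe]
  change ∫ y, f y ∂(Measure.map ((Ico 0 P).domRestrict γ) _) = _
  rw [he.integral_map, (MeasurableEmbedding.subtype_coe measurableSet_Ico).integral_map]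
  rfl

lemma integrable_map_iff (h : IsArcLengthJordanCurve P γ) {F : Type*} [NormedAddCommGroup F]
    (f : Plane → F) :
    Integrable f ((volume.restrict (Ico 0 P)).map γ) ↔
      IntegrableOn (fun t => f (γ t)) (Ico 0 P) := by
  have he := h.continuous.continuousOn.measurableEmbedding measurableSet_Ico h.injOn
  rw [IntegrableOn, ← map_comap_subtype_coe measurableSet_Ico,
    Measure.map_map h.continuous.measurable measurable_subtype_coe]
  change Integrable f (Measure.map ((Ico 0 P).domRestrict γ) _) ↔ _
  rw [he.integrable_map_iff, (MeasurableEmbedding.subtype_coe measurableSet_Ico).integrable_map_iff]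
  rfl

end IsArcLengthJordanCurve

/-! ### Domains bounded by finitely many curves -/

/-- `Ω` is a domain of finite area with `C²` boundary, and its boundary is the disjoint union of the
positively oriented curves `γ i`. -/
structure IsBoundedBy (Ω : Set Plane) {N : ℕ} (P : Fin N → ℝ) (γ : Fin N → ℝ → Plane) : Prop where
  nullMeasurable : NullMeasurableSet Ω volume
  area : volume Ω < ⊤
  c2 : HasC2Boundary Ω
  curve : ∀ i, IsArcLengthJordanCurve (P i) (γ i)
  disjoint_range : ∀ i j, i ≠ j → Disjoint (range (γ i)) (range (γ j))
  frontier_eq : frontier Ω = ⋃ i, range (γ i)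
  oriented : ∀ i, IsPositivelyOriented Ω (γ i)

/-- `ρ` is a defining function of `Ω` in the open set `U`. -/
structure IsDefiningOn (Ω U : Set Plane) (ρ : Plane → ℝ) : Prop where
  isOpen : IsOpen U
  contDiffOn : ContDiffOn ℝ 2 ρ U
  fderiv_ne : ∀ x ∈ U, fderiv ℝ ρ x ≠ 0
  sign : ∀ x ∈ U, (ρ x < 0 → x ∈ Ω) ∧ (0 < ρ x → x ∉ Ω)

lemma IsDefiningOn.differentiableAt {Ω U : Set Plane} {ρ : Plane → ℝ} (h : IsDefiningOn Ω U ρ)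
    {x : Plane} (hx : x ∈ U) : DifferentiableAt ℝ ρ x :=
  (h.contDiffOn.differentiableOn two_ne_zero).differentiableAt (h.isOpen.mem_nhds hx)

lemma IsDefiningOn.contDiffOn_fderiv {Ω U : Set Plane} {ρ : Plane → ℝ} (h : IsDefiningOn Ω U ρ) :
    ContDiffOn ℝ 1 (fderiv ℝ ρ) U :=
  h.contDiffOn.fderiv_of_isOpen h.isOpen (by norm_num)

/-- A strict sign of `ρ` at `x` would persist nearby and place a whole neighbourhood inside or
outside `Ω`. -/
lemma IsDefiningOn.eq_zero_of_mem_frontier {Ω U : Set Plane} {ρ : Plane → ℝ}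
    (h : IsDefiningOn Ω U ρ) {x : Plane} (hx : x ∈ U) (hf : x ∈ frontier Ω) : ρ x = 0 := by
  have hc : ContinuousAt ρ x := (h.differentiableAt hx).continuousAt
  have hU : ∀ᶠ y in 𝓝 x, y ∈ U := h.isOpen.mem_nhds hx
  rcases lt_trichotomy (ρ x) 0 with h1 | h1 | h1
  · exfalso
    have : ∀ᶠ y in 𝓝 x, y ∈ Ω := by
      filter_upwards [hU, hc.eventually (gt_mem_nhds h1)] with y hy hy' using (h.sign y hy).1 hy'
    exact hf.2 (mem_interior_iff_mem_nhds.2 this)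
  · exact h1
  · exfalso
    have : ∀ᶠ y in 𝓝 x, y ∉ Ω := by
      filter_upwards [hU, hc.eventually (lt_mem_nhds h1)] with y hy hy' using (h.sign y hy).2 hy'
    obtain ⟨y, hy1, hy2⟩ := mem_closure_iff_nhds.1 hf.1 _ this
    exact hy1 hy2

namespace IsBoundedBy

variable {Ω : Set Plane} {N : ℕ} {P : Fin N → ℝ} {γ : Fin N → ℝ → Plane}

lemma mem_frontier (h : IsBoundedBy Ω P γ) (i : Fin N) (t : ℝ) : γ i t ∈ frontier Ω := by
  rw [h.frontier_eq]; exact mem_iUnion_of_mem i (mem_range_self t)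

lemma isCompact_frontier (h : IsBoundedBy Ω P γ) : IsCompact (frontier Ω) := by
  rw [h.frontier_eq]; exact isCompact_iUnion fun i => (h.curve i).isCompact_range

lemma ne_of_ne (h : IsBoundedBy Ω P γ) {i j : Fin N} (hij : i ≠ j) (t s : ℝ) : γ i t ≠ γ j s :=
  fun he => disjoint_left.1 (h.disjoint_range i j hij) (mem_range_self t) ⟨s, he.symm⟩

/-- Since `ρ` vanishes along `γ`, its derivative kills the tangent and is a multiple of the normal
component, nonzero as `ρ` has no critical points. The orientation fixes the sign: an increase of `ρ`
towards `γ'^⊥` would contradict that this side belongs to `Ω`. -/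
lemma fderiv_defining (h : IsBoundedBy Ω P γ) {U : Set Plane} {ρ : Plane → ℝ}
    (hρ : IsDefiningOn Ω U ρ) {i : Fin N} {t : ℝ} (ht : γ i t ∈ U) :
    ∃ l : ℝ, 0 < l ∧ ∀ v, fderiv ℝ ρ (γ i t) v = -l * inner ℝ v (perp (deriv (γ i) t)) := by
  have hγ := h.curve i
  have hd := (hρ.differentiableAt ht).hasFDerivAt
  have h0 : fderiv ℝ ρ (γ i t) (deriv (γ i) t) = 0 := by
    have h1 : HasDerivAt (fun s => ρ (γ i s)) (fderiv ℝ ρ (γ i t) (deriv (γ i) t)) t :=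
      hd.comp_hasDerivAt t (hγ.hasDerivAt t)
    have h2 : (fun s => ρ (γ i s)) =ᶠ[𝓝 t] fun _ => (0 : ℝ) := by
      filter_upwards [hγ.continuous.continuousAt.eventually (hρ.isOpen.mem_nhds ht)] with s hs
      exact hρ.eq_zero_of_mem_frontier hs (h.mem_frontier i s)
    exact h1.unique ((hasDerivAt_const t (0 : ℝ)).congr_of_eventuallyEq h2)
  set n := perp (deriv (γ i) t) with hn
  have hdec : ∀ v, fderiv ℝ ρ (γ i t) v = fderiv ℝ ρ (γ i t) n * inner ℝ v n := by
    intro v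
    conv_lhs => rw [frame_decomp (hγ.arcLength t) v, map_add, map_smul, map_smul, h0]
    rw [smul_zero, zero_add, smul_eq_mul, mul_comm]
  have hne : fderiv ℝ ρ (γ i t) n ≠ 0 := by
    intro he
    refine hρ.fderiv_ne _ ht ?_
    ext v
    rw [hdec v, he]; simp
  have hle : ¬ 0 < fderiv ℝ ρ (γ i t) n := by
    intro hpos
    have h1 : HasDerivAt (fun e : ℝ => γ i t + e • n) n 0 := by
      simpa using ((hasDerivAt_id (0 : ℝ)).smul_const n).const_add (γ i t)
    have h2 : HasDerivAt (fun e : ℝ => ρ (γ i t + e • n)) (fderiv ℝ ρ (γ i t) n) 0 :=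
      HasFDerivAt.comp_hasDerivAt (f := fun e : ℝ => γ i t + e • n) 0 (by simpa using hd) h1
    have hz : ρ (γ i t) = 0 := hρ.eq_zero_of_mem_frontier ht (h.mem_frontier i t)
    have h3 : ∀ᶠ e : ℝ in 𝓝[>] 0, 0 < ρ (γ i t + e • n) := by
      have := h2.tendsto_slope_zero_right.eventually (lt_mem_nhds hpos)
      filter_upwards [this, self_mem_nhdsWithin] with e he (he' : 0 < e)
      simp only [zero_add, zero_smul, add_zero, hz, sub_zero, smul_eq_mul] at he
      exact (mul_pos_iff_of_pos_left (inv_pos.2 he')).1 he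
    have h4 : ∀ᶠ e : ℝ in 𝓝[>] 0, γ i t + e • n ∈ U := by
      have : Tendsto (fun e : ℝ => γ i t + e • n) (𝓝[>] 0) (𝓝 (γ i t)) := by
        simpa using h1.continuousAt.tendsto.mono_left nhdsWithin_le_nhds
      exact this.eventually (hρ.isOpen.mem_nhds ht)
    obtain ⟨e, he1, he2, he3⟩ := (h3.and (h4.and (h.oriented i t))).exists
    exact (hρ.sign _ he2).2 he1 he3
  refine ⟨-fderiv ℝ ρ (γ i t) n, by
    rcases lt_or_gt_of_ne hne with h1 | h1
    · linarith
    · exact absurd h1 hle, fun v => ?_⟩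
  rw [hdec v]; ring

lemma exists_defining (h : IsBoundedBy Ω P γ) {p : Plane} (hp : p ∈ frontier Ω) :
    ∃ U ρ, p ∈ U ∧ IsDefiningOn Ω U ρ := by
  obtain ⟨U, ρ, h1, h2, h3, h4, h5⟩ := h.c2 p hp
  exact ⟨U, ρ, h2, h1, h3, h4, h5⟩

/-- Near a boundary point, `Ω` lies on the left of the curve. -/
lemma exists_local_sides (h : IsBoundedBy Ω P γ) (i : Fin N) (t₀ : ℝ) :
    ∃ r : ℝ, 0 < r ∧ ∀ t, |t - t₀| < r → 0 < inner ℝ (deriv (γ i) t) (deriv (γ i) t₀) ∧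
      ∀ w : ℝ, 0 < w → w < r → γ i t + w • perp (deriv (γ i) t₀) ∈ Ω ∧
        γ i t + (-w) • perp (deriv (γ i) t₀) ∉ Ω := by
  have hγ := h.curve i
  obtain ⟨U, ρ, hpU, hρ⟩ := h.exists_defining (h.mem_frontier i t₀)
  obtain ⟨l, hl, hfd⟩ := h.fderiv_defining hρ hpU
  set n := perp (deriv (γ i) t₀) with hn
  have hnn : ‖n‖ = 1 := by rw [hn, norm_perp, hγ.arcLength]
  have hneg : fderiv ℝ ρ (γ i t₀) n < 0 := by
    rw [hfd, real_inner_self_eq_norm_sq, hnn]; linarith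
  have hcont : ContinuousAt (fun x => fderiv ℝ ρ x n) (γ i t₀) :=
    (hρ.contDiffOn_fderiv.continuousOn.continuousAt (hρ.isOpen.mem_nhds hpU)).clm_apply
      continuousAt_const
  have hev : ∀ᶠ x in 𝓝 (γ i t₀), x ∈ U ∧ fderiv ℝ ρ x n < 0 :=
    (hρ.isOpen.eventually_mem hpU).and (hcont.eventually (gt_mem_nhds hneg))
  obtain ⟨r₁, hr₁, hball⟩ := Metric.eventually_nhds_iff.1 hev
  have hpos : ∀ᶠ t in 𝓝 t₀, 0 < inner ℝ (deriv (γ i) t) (deriv (γ i) t₀) := by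
    have hc : Continuous fun t => inner ℝ (deriv (γ i) t) (deriv (γ i) t₀) :=
      hγ.continuous_deriv.inner continuous_const
    refine hc.continuousAt.eventually (lt_mem_nhds ?_)
    beta_reduce
    rw [real_inner_self_eq_norm_sq, hγ.arcLength]; norm_num
  obtain ⟨r₂, hr₂, hpos⟩ := Metric.eventually_nhds_iff.1 hpos
  -- Halving `r₁` leaves room for both displacements: `γ t + e n` is within `|t - t₀| + |e| < r₁` of
  -- the base point.
  refine ⟨min (r₁ / 2) r₂, by positivity, fun t ht => ⟨hpos ?_, fun w hw hwr => ?_⟩⟩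
  · rw [Real.dist_eq]; exact ht.trans_le (min_le_right _ _)
  have hmem : ∀ e : ℝ, |e| ≤ w → γ i t + e • n ∈ U ∧ fderiv ℝ ρ (γ i t + e • n) n < 0 := by
    intro e he
    refine hball ?_
    have h1 : dist (γ i t + e • n) (γ i t₀) ≤ ‖γ i t - γ i t₀‖ + ‖e • n‖ := by
      rw [dist_eq_norm, add_sub_right_comm]; exact norm_add_le _ _
    have h2 := hγ.norm_sub_le t t₀
    rw [norm_smul, hnn, mul_one, Real.norm_eq_abs] at h1
    have h3 := min_le_left (r₁ / 2) r₂
    linarith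
  have hz : ρ (γ i t) = 0 := by
    have := (hmem 0 (by simpa using hw.le)).1
    rw [zero_smul, add_zero] at this
    exact hρ.eq_zero_of_mem_frontier this (h.mem_frontier i t)
  have hderiv : ∀ e : ℝ, |e| ≤ w →
      HasDerivAt (fun e : ℝ => ρ (γ i t + e • n)) (fderiv ℝ ρ (γ i t + e • n) n) e := by
    intro e he
    have h1 : HasDerivAt (fun e : ℝ => γ i t + e • n) n e := by
      simpa using ((hasDerivAt_id e).smul_const n).const_add (γ i t)
    exact (hρ.differentiableAt (hmem e he).1).hasFDerivAt.comp_hasDerivAt e h1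
  -- Along the normal segment `ρ` is strictly decreasing and vanishes at `e = 0`, so its sign, and
  -- hence membership in `Ω`, is decided on each side.
  have hanti : StrictAntiOn (fun e : ℝ => ρ (γ i t + e • n)) (Icc (-w) w) := by
    refine strictAntiOn_of_deriv_neg (convex_Icc _ _)
      (fun e he => (hderiv e (abs_le.2 he)).continuousAt.continuousWithinAt) fun e he => ?_
    rw [interior_Icc] at he
    have he' := abs_le.2 (Ioo_subset_Icc_self he)
    rw [(hderiv e he').deriv]
    exact (hmem e he').2
  constructor
  · refine (hρ.sign _ (hmem w (abs_of_pos hw).le).1).1 ?_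
    have := hanti (a := 0) (b := w) ⟨by linarith, hw.le⟩ ⟨by linarith, le_rfl⟩ hw
    simpa [hz] using this
  · refine (hρ.sign _ (hmem (-w) (by rw [abs_neg, abs_of_pos hw])).1).2 ?_
    have := hanti (a := -w) (b := 0) ⟨le_rfl, by linarith⟩ ⟨by linarith, hw.le⟩ (by linarith)
    simpa [hz] using this

/-- A connected set that does not meet the boundary of `Ω` and meets `Ω` is contained in `Ω`. -/
lemma _root_.IsPreconnected.subset_of_disjoint_frontier {X : Type*} [TopologicalSpace X]
    {s Ω : Set X} (hs : IsPreconnected s) (hd : Disjoint s (frontier Ω)) (hne : (s ∩ Ω).Nonempty) :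
    s ⊆ Ω := by
  have hcl : ∀ x ∈ s, x ∈ closure Ω → x ∈ interior Ω := fun x hx hxc => by
    by_contra hxi
    exact disjoint_left.1 hd hx ⟨hxc, hxi⟩
  refine (hs.subset_left_of_subset_union (v := (closure Ω)ᶜ) isOpen_interior
    isClosed_closure.isOpen_compl
    ?_ ?_ ?_).trans interior_subset
  · exact disjoint_left.2 fun x hx hx' => hx' (interior_subset_closure hx)
  · intro x hx
    by_cases hxc : x ∈ closure Ω
    · exact Or.inl (hcl x hx hxc)
    · exact Or.inr hxc
  · obtain ⟨x, hx, hxΩ⟩ := hne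
    exact ⟨x, hx, hcl x hx (subset_closure hxΩ)⟩

/-- The frontier lies in a disk of radius `R`. A point `x` of `Ω` outside that disk lies in a
half-plane disjoint from it; being connected and meeting `Ω`, this half-plane is contained in `Ω`,
which contradicts finite area. -/
lemma isBounded (h : IsBoundedBy Ω P γ) : Bornology.IsBounded Ω := by
  obtain ⟨R, hR⟩ := h.isCompact_frontier.isBounded.subset_closedBall (0 : Plane)
  rw [Metric.isBounded_iff_subset_closedBall (0 : Plane)]
  refine ⟨max R 0, fun x hx => ?_⟩
  by_contra hxR
  have hxR : max R 0 < ‖x‖ := by simpa using hxR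
  have hx0 : 0 < ‖x‖ := (le_max_right _ _).trans_lt hxR
  have hRx : R < ‖x‖ := (le_max_left _ _).trans_lt hxR
  set s : Set Plane := {z | R * ‖x‖ < inner ℝ x z} with hs
  have hsΩ : s ⊆ Ω := by
    have hconv : Convex ℝ s := by
      have := convex_halfSpace_gt (𝕜 := ℝ) (f := fun z => inner ℝ x z) (innerₗ Plane x).isLinear
        (R * ‖x‖)
      exact this
    refine hconv.isPreconnected.subset_of_disjoint_frontier ?_ ⟨x, ?_, hx⟩
    · refine disjoint_left.2 fun z hz hzf => ?_
      have h1 : ‖z‖ ≤ R := by simpa using hR hzf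
      have h2 := real_inner_le_norm x z
      have h3 : R * ‖x‖ < inner ℝ x z := hz
      nlinarith
    · change R * ‖x‖ < inner ℝ x x
      rw [real_inner_self_eq_norm_sq]; nlinarith
  have hball : ∀ n : ℕ, volume (Metric.ball (0 : Plane) n) ≤ volume Ω := by
    intro n
    -- A centre at distance `n + |R|` from the origin in the direction of `x`, so that the disk of
    -- radius `n` stays in the half-plane.
    set c : Plane := ((n + |R|) / ‖x‖) • x
    rw [← Measure.addHaar_ball_center volume c]
    refine measure_mono (Subset.trans (fun z hz => ?_) hsΩ)
    have h1 : ‖z - c‖ < n := by simpa [dist_eq_norm] using hz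
    have h2 : inner ℝ x c = (n + |R|) * ‖x‖ := by
      rw [inner_smul_right, real_inner_self_eq_norm_sq]; field_simp
    have h3 : inner ℝ x z = inner ℝ x c + inner ℝ x (z - c) := by rw [← inner_add_right]; simp
    have h4 := neg_le_of_abs_le (abs_real_inner_le_norm x (z - c))
    change R * ‖x‖ < inner ℝ x z
    rw [h3, h2]
    have h5 := le_abs_self R
    nlinarith
  have htop : Tendsto (fun n : ℕ => volume (Metric.ball (0 : Plane) n)) atTop (𝓝 ⊤) := by
    have hm : Monotone fun n : ℕ => Metric.ball (0 : Plane) n := fun m n hmn =>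
      Metric.ball_subset_ball (by exact_mod_cast hmn)
    have := tendsto_measure_iUnion_atTop (μ := (volume : Measure Plane)) hm
    rwa [Metric.iUnion_ball_nat, measure_univ_of_isAddLeftInvariant] at this
  exact absurd (le_of_tendsto' htop hball) (not_le.2 h.area)

/-- The outer unit normal `-γ'^⊥` on the boundary extends to a test field of norm at most one. -/
lemma exists_normal_extension (h : IsBoundedBy Ω P γ) :
    ∃ n₀ : Plane → Plane, IsTestField n₀ ∧ (∀ x, ‖n₀ x‖ ≤ 1) ∧
      ∀ i t, n₀ (γ i t) = -perp (deriv (γ i) t) := by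
  obtain ⟨R, hR⟩ := h.isCompact_frontier.isBounded.subset_ball (0 : Plane)
  -- All three requirements on the value `v` are convex, so local choices can be glued by a
  -- partition of unity. Near the boundary the local choice is the normalized gradient of a defining
  -- function, elsewhere it is zero.
  set T : Plane → Set Plane := fun x => {v | ‖v‖ ≤ 1 ∧
    (∀ i s, γ i s = x → v = -perp (deriv (γ i) s)) ∧ (x ∉ Metric.ball (0 : Plane) R → v = 0)}
  have hT : ∀ x, Convex ℝ (T x) := by
    intro x v hv w hw a b ha hb hab
    refine ⟨?_, fun i s his => ?_, fun hx => ?_⟩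
    · have := convex_closedBall (0 : Plane) 1 (x := v) (y := w) (by simpa using hv.1)
        (by simpa using hw.1) ha hb hab
      simpa using this
    · rw [hv.2.1 i s his, hw.2.1 i s his, ← add_smul, hab, one_smul]
    · rw [hv.2.2 hx, hw.2.2 hx]; simp
  obtain ⟨g, hg⟩ := exists_contMDiffMap_forall_mem_convex_of_local (n := 1)
    (modelWithCornersSelf ℝ Plane) hT (by
    intro x
    by_cases hx : x ∈ frontier Ω
    · obtain ⟨U, ρ, hxU, hρ⟩ := h.exists_defining hx
      set G : Plane → Plane := fun y => (InnerProductSpace.toDual ℝ Plane).symm (fderiv ℝ ρ y)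
      have hG : ContDiffOn ℝ 1 G U :=
        (InnerProductSpace.toDual ℝ Plane).symm.contDiff.comp_contDiffOn hρ.contDiffOn_fderiv
      have hG0 : ∀ y ∈ U, G y ≠ 0 := fun y hy h0 =>
        hρ.fderiv_ne y hy ((LinearIsometryEquiv.map_eq_zero_iff _).1 h0)
      refine ⟨U ∩ Metric.ball 0 R, inter_mem (hρ.isOpen.mem_nhds hxU)
        (Metric.isOpen_ball.mem_nhds (hR hx)), fun y => ‖G y‖⁻¹ • G y, ?_, ?_⟩
      · refine ContDiffOn.contMDiffOn ?_
        have hn : ContDiffOn ℝ 1 (fun y => ‖G y‖⁻¹) U :=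
          (hG.norm ℝ hG0).inv fun y hy => norm_ne_zero_iff.2 (hG0 y hy)
        exact (hn.smul hG).mono inter_subset_left
      · rintro y ⟨hyU, hyR⟩
        refine ⟨?_, ?_, fun hy => absurd hyR hy⟩
        · rw [norm_smul, norm_inv, norm_norm, inv_mul_cancel₀ (norm_ne_zero_iff.2 (hG0 y hyU))]
        · rintro i s rfl
          obtain ⟨l, hl, hfd⟩ := h.fderiv_defining hρ hyU
          have hGe : G (γ i s) = -l • perp (deriv (γ i) s) := by
            refine ext_inner_right ℝ fun v => ?_
            rw [InnerProductSpace.toDual_symm_apply, hfd v, real_inner_smul_left,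
              real_inner_comm]
          dsimp only
          rw [hGe, norm_smul, norm_perp, (h.curve i).arcLength, mul_one, Real.norm_eq_abs, abs_neg,
            abs_of_pos hl, smul_smul, mul_neg, inv_mul_cancel₀ hl.ne', neg_one_smul]
    · refine ⟨(frontier Ω)ᶜ, isClosed_frontier.isOpen_compl.mem_nhds hx, fun _ => 0,
        contMDiffOn_const, fun y hy => ⟨by simp, ?_, fun _ => rfl⟩⟩
      rintro i s rfl
      exact absurd (h.mem_frontier i s) hy)
  refine ⟨g, ⟨g.contMDiff.contDiff, ?_⟩, fun x => (hg x).1, fun i t => (hg _).2.1 i t rfl⟩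
  refine HasCompactSupport.intro (isCompact_closedBall (0 : Plane) R) fun x hx => ?_
  exact (hg x).2.2 fun hx' => hx (Metric.ball_subset_closedBall hx')

end IsBoundedBy

/-! ### The Gauss-Green formula -/

/-- Integration by parts against the constant `1`, one derivative at a time. -/
lemma integral_divergence_eq_zero {φ : Plane → Plane} (hφ : IsTestField φ) :
    ∫ x, divergence φ x = 0 := by
  have hint : ∀ v, Integrable (fun x => fderiv ℝ φ x v) := fun v =>
    ((hφ.1.continuous_fderiv one_ne_zero).clm_apply continuous_const).integrable_of_hasCompactSupport
      ((hφ.2.fderiv ℝ).comp_left (g := fun L : Plane →L[ℝ] Plane => L v) rfl)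
  have hφi : Integrable φ := hφ.1.continuous.integrable_of_hasCompactSupport hφ.2
  have hz : ∀ v, ∫ x, fderiv ℝ φ x v = 0 := fun v => by
    have := integral_smul_fderiv_eq_neg_fderiv_smul_of_integrable (𝕜 := ℝ) (μ := volume)
      (f := fun _ : Plane => (1 : ℝ)) (g := φ) (v := v) (by simp) (by simpa using hint v)
      (by simpa using hφi) (fun _ _ => by fun_prop)
      (fun x _ => hφ.1.differentiable one_ne_zero x)
    simpa using this
  have hcoord : ∀ (i : Fin 2) v, Integrable (fun x => fderiv ℝ φ x v i) ∧
      ∫ x, fderiv ℝ φ x v i = 0 := fun i v => by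
    refine ⟨(EuclideanSpace.proj (𝕜 := ℝ) i).integrable_comp (hint v), ?_⟩
    have := (EuclideanSpace.proj i : Plane →L[ℝ] ℝ).integral_comp_comm (hint v)
    rw [hz v, map_zero] at this
    exact this
  unfold divergence
  rw [integral_finsetSum _ fun i _ => (hcoord i _).1]
  exact Finset.sum_eq_zero fun i _ => (hcoord i _).2

/-- The divergence theorem in a strip on the left of a curve, in the coordinates
`(t, w) ↦ γ t + w τ^⊥`. -/
lemma integral_divergence_strip {P : ℝ} {γ : ℝ → Plane} (hγ : IsArcLengthJordanCurve P γ)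
    {φ : Plane → Plane} (hφ : ContDiff ℝ 1 φ) {τ : Plane} (hτ : ‖τ‖ = 1) {a b r : ℝ}
    (ha : ∀ w : ℝ, φ (γ a + w • perp τ) = 0) (hb : ∀ w : ℝ, φ (γ b + w • perp τ) = 0)
    (hr : ∀ t ∈ uIcc a b, φ (γ t + r • perp τ) = 0) :
    ∫ t in a..b, ∫ w in (0 : ℝ)..r, inner ℝ (deriv γ t) τ * divergence φ (γ t + w • perp τ) =
      ∫ t in a..b, inner ℝ (φ (γ t)) (-perp (deriv γ t)) := by
  set Φ : ℝ × ℝ → Plane := fun p => γ p.1 + p.2 • perp τ with hΦ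
  have hΦc : ContDiff ℝ 1 Φ :=
    ((hγ.contDiff.of_le one_le_two).comp contDiff_fst).add (contDiff_snd.smul contDiff_const)
  -- `(f, g)` is the field `φ` pulled back to the `(t, w)` rectangle (Piola transform). Its flat
  -- divergence is the Jacobian `γ' · τ` times `div φ`, so the divergence theorem on a rectangle
  -- applies.
  set f : ℝ × ℝ → ℝ := fun p => inner ℝ (φ (Φ p)) τ with hf
  set g : ℝ × ℝ → ℝ := fun p => inner ℝ (φ (Φ p)) (perp (deriv γ p.1)) with hg
  have hfc : ContDiff ℝ 1 f := (hφ.comp hΦc).inner ℝ contDiff_const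
  have hgc : ContDiff ℝ 1 g :=
    (hφ.comp hΦc).inner ℝ (contDiff_perp.comp (hγ.contDiff_deriv.comp contDiff_fst))
  have hφd : ∀ x, HasFDerivAt φ (fderiv ℝ φ x) x := fun x =>
    (hφ.differentiable one_ne_zero x).hasFDerivAt
  have hf' : ∀ p, fderiv ℝ f p (1, 0) = inner ℝ (fderiv ℝ φ (Φ p) (deriv γ p.1)) τ := by
    rintro ⟨t, w⟩
    have h1 : HasDerivAt (fun s : ℝ => (s, w)) ((1 : ℝ), (0 : ℝ)) t :=
      (hasDerivAt_id t).prodMk (hasDerivAt_const t w)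
    have h2 := (hfc.differentiable one_ne_zero (t, w)).hasFDerivAt.comp_hasDerivAt t h1
    have h3 : HasDerivAt (fun s : ℝ => Φ (s, w)) (deriv γ t) t :=
      (hγ.hasDerivAt t).add_const (w • perp τ)
    have h4 := ((hφd (Φ (t, w))).comp_hasDerivAt t h3).inner ℝ (hasDerivAt_const t τ)
    simp only [inner_zero_right, zero_add] at h4
    exact h2.unique h4
  have hg' : ∀ p, fderiv ℝ g p (0, 1) =
      inner ℝ (fderiv ℝ φ (Φ p) (perp τ)) (perp (deriv γ p.1)) := by
    rintro ⟨t, w⟩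
    have h1 : HasDerivAt (fun s : ℝ => (t, s)) ((0 : ℝ), (1 : ℝ)) w :=
      (hasDerivAt_const w t).prodMk (hasDerivAt_id w)
    have h2 := (hgc.differentiable one_ne_zero (t, w)).hasFDerivAt.comp_hasDerivAt w h1
    have h3 : HasDerivAt (fun s : ℝ => Φ (t, s)) (perp τ) w := by
      have := ((hasDerivAt_id w).smul_const (perp τ)).const_add (γ t)
      rw [one_smul] at this
      exact this
    have h4 := ((hφd (Φ (t, w))).comp_hasDerivAt w h3).inner ℝ
      (hasDerivAt_const w (perp (deriv γ t)))
    simp only [inner_zero_right, zero_add] at h4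
    exact h2.unique h4
  have hsum : ∀ p, fderiv ℝ f p (1, 0) + fderiv ℝ g p (0, 1) =
      inner ℝ (deriv γ p.1) τ * divergence φ (Φ p) := by
    intro p
    rw [hf', hg', divergence_eq_frame hτ, perp_frame_decomp hτ (deriv γ p.1)]
    conv_lhs => rw [frame_decomp hτ (deriv γ p.1)]
    simp only [map_add, map_smul, inner_add_left, inner_sub_right, real_inner_smul_left,
      real_inner_smul_right]
    simp only [real_inner_self_eq_norm_sq, hτ, norm_perp, inner_perp_self, inner_self_perp]
    ring
  -- By the vanishing hypotheses only the edge `w = 0`, which is the curve itself, contributes.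
  have key := integral2_divergence_prod_of_hasFDerivAt f g (fderiv ℝ f) (fderiv ℝ g) a 0 b r
    hfc.continuous.continuousOn hgc.continuous.continuousOn
    (fun p _ => (hfc.differentiable one_ne_zero p).hasFDerivAt)
    (fun p _ => (hgc.differentiable one_ne_zero p).hasFDerivAt)
    (ContinuousOn.integrableOn_compact (isCompact_uIcc.prod isCompact_uIcc)
      (((hfc.continuous_fderiv one_ne_zero).clm_apply continuous_const).add
        ((hgc.continuous_fderiv one_ne_zero).clm_apply continuous_const)).continuousOn)
  simp only [hsum] at key
  have e1 : ∫ t in a..b, g (t, r) = 0 := by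
    rw [intervalIntegral.integral_congr (g := fun _ => (0 : ℝ)) fun t ht => by
      simp [hg, hΦ, hr t ht]]
    simp
  have e2 : ∫ w in (0 : ℝ)..r, f (b, w) = 0 := by simp [hf, hΦ, hb]
  have e3 : ∫ w in (0 : ℝ)..r, f (a, w) = 0 := by simp [hf, hΦ, ha]
  rw [e1, e2, e3] at key
  simp only [hΦ, hg, zero_smul, add_zero, zero_sub, sub_zero] at key
  simp only [inner_neg_right, intervalIntegral.integral_neg]
  exact key

/-- Fubini's theorem in the coordinates `(t, w) ↦ γ t + w τ^⊥`. -/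
lemma integral_curve_coordinates {P : ℝ} {γ : ℝ → Plane} (hγ : IsArcLengthJordanCurve P γ)
    {τ : Plane} (hτ : ‖τ‖ = 1) {a b : ℝ} (hab : a ≤ b)
    (hpos : ∀ t ∈ Icc a b, 0 < inner ℝ (deriv γ t) τ) {F : Plane → ℝ} (hF : Integrable F)
    (hsupp : ∀ x, F x ≠ 0 → inner ℝ x τ ∈ Icc (inner ℝ (γ a) τ) (inner ℝ (γ b) τ)) :
    ∫ x, F x = ∫ t in a..b, inner ℝ (deriv γ t) τ * ∫ w : ℝ, F (γ t + w • perp τ) := by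
  set X : ℝ → ℝ := fun t => inner ℝ (γ t) τ with hX
  have hXd : ∀ t, HasDerivAt X (inner ℝ (deriv γ t) τ) t := fun t => by
    have := (hγ.hasDerivAt t).inner ℝ (hasDerivAt_const t τ)
    simpa using this
  have hXc : ContinuousOn X (Icc a b) := fun t _ => (hXd t).continuousAt.continuousWithinAt
  have hmono : StrictMonoOn X (Icc a b) := by
    refine strictMonoOn_of_deriv_pos (convex_Icc _ _) hXc fun t ht => ?_
    rw [(hXd t).deriv]
    exact hpos t (interior_subset ht)
  have himg : X '' Icc a b = Icc (X a) (X b) := by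
    refine Subset.antisymm ?_ (intermediate_value_Icc hab hXc)
    rintro _ ⟨t, ht, rfl⟩
    exact ⟨hmono.monotoneOn (left_mem_Icc.2 hab) ht ht.1,
      hmono.monotoneOn ht (right_mem_Icc.2 hab) ht.2⟩
  rw [integral_frame hτ hF]
  set G : ℝ → ℝ := fun u => ∫ w : ℝ, F (u • τ + w • perp τ) with hG
  have hGsupp : ∀ u, u ∉ Icc (X a) (X b) → G u = 0 := by
    intro u hu
    refine integral_eq_zero_of_ae (Eventually.of_forall fun w => ?_)
    by_contra hne
    have := hsupp _ hne
    rw [inner_add_left, real_inner_smul_left, real_inner_smul_left, inner_perp_self,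
      real_inner_self_eq_norm_sq, hτ] at this
    exact hu (by simpa using this)
  have h1 : ∫ u, G u = ∫ u in X '' Icc a b, G u := by
    rw [himg, setIntegral_eq_integral_of_forall_compl_eq_zero hGsupp]
  rw [h1, integral_image_eq_integral_abs_deriv_smul measurableSet_Icc
    (fun t _ => (hXd t).hasDerivWithinAt) hmono.injOn, intervalIntegral.integral_of_le hab,
    ← integral_Icc_eq_integral_Ioc]
  refine setIntegral_congr_fun measurableSet_Icc fun t ht => ?_
  rw [abs_of_pos (hpos t ht), smul_eq_mul]
  congr 1
  change ∫ w : ℝ, F (X t • τ + w • perp τ) = _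
  -- Translating `w` by the normal coordinate of `γ t` makes the vertical line start on the curve.
  rw [← integral_add_right_eq_self (fun w : ℝ => F (X t • τ + w • perp τ))
    (inner ℝ (γ t) (perp τ))]
  refine integral_congr_ae (Eventually.of_forall fun w => ?_)
  dsimp only
  conv_rhs => rw [frame_decomp hτ (γ t)]
  rw [add_smul]
  congr 1
  abel

namespace IsBoundedBy

variable {Ω : Set Plane} {N : ℕ} {P : Fin N → ℝ} {γ : Fin N → ℝ → Plane}

/-- The Gauss-Green formula holds locally at a boundary point. -/
lemma gaussGreen_local (h : IsBoundedBy Ω P γ) (i : Fin N) (t₀ : ℝ) :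
    ∃ U : Set Plane, IsOpen U ∧ γ i t₀ ∈ U ∧ ∀ φ, IsTestField φ → tsupport φ ⊆ U →
      ∫ x in Ω, divergence φ x =
        ∑ j, ∫ t in (0 : ℝ)..P j, inner ℝ (φ (γ j t)) (-perp (deriv (γ j) t)) := by
  have hγ := h.curve i
  have hP := hγ.length_pos
  obtain ⟨r₀, hr₀, hsides⟩ := h.exists_local_sides i t₀
  set τ := deriv (γ i) t₀ with hτdef
  have hτ : ‖τ‖ = 1 := hγ.arcLength t₀
  set r : ℝ := min r₀ (P i) / 2 with hr
  have hrpos : 0 < r := by positivity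
  have hrr₀ : r < r₀ := by
    have := min_le_left r₀ (P i); rw [hr]; linarith
  have hrP : r < P i := by
    have := min_le_right r₀ (P i); rw [hr]; linarith
  -- Points of the arc over `[a, b]` have normal coordinate at most `η = r / 2` in absolute value,
  -- so moving by `|w| ≥ r` leaves the strip of half-width `η`. The bound `r < P i` ensures `b ≤ a +
  -- P i`.
  set η : ℝ := r / 2 with hη
  have hηpos : 0 < η := by positivity
  set a := t₀ - η with ha
  set b := t₀ + η with hb
  have hab : a ≤ b := by linarith
  have hlt : ∀ t ∈ Icc a b, |t - t₀| < r₀ := fun t ht => by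
    rw [abs_lt]; constructor <;> linarith [ht.1, ht.2]
  have hpos : ∀ t ∈ Icc a b, 0 < inner ℝ (deriv (γ i) t) τ := fun t ht => (hsides t (hlt t ht)).1
  have hXd : ∀ t, HasDerivAt (fun t => inner ℝ (γ i t) τ) (inner ℝ (deriv (γ i) t) τ) t := by
    intro t
    have := (hγ.hasDerivAt t).inner ℝ (hasDerivAt_const t τ)
    simpa using this
  have hmono : StrictMonoOn (fun t => inner ℝ (γ i t) τ) (Icc a b) := by
    refine strictMonoOn_of_deriv_pos (convex_Icc _ _)
      (fun t _ => (hXd t).continuousAt.continuousWithinAt) fun t ht => ?_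
    rw [(hXd t).deriv]
    exact hpos t (interior_subset ht)
  -- The part of the boundary away from the chosen arc. Removing it from `U` ensures that a field
  -- supported in `U` sees only the arc over `[a, b]`.
  set C : Set Plane := (⋃ j ∈ {j | j ≠ i}, range (γ j)) ∪ γ i '' Icc b (a + P i) with hC
  have hCclosed : IsClosed C := by
    refine IsClosed.union ?_ (isCompact_Icc.image hγ.continuous).isClosed
    exact (toFinite _).isClosed_biUnion fun j _ => (h.curve j).isCompact_range.isClosed
  have hpC : γ i t₀ ∉ C := by
    rintro (hp | ⟨t, ht, hte⟩)
    · simp only [mem_iUnion] at hp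
      obtain ⟨j, hj, s, hs⟩ := hp
      exact h.ne_of_ne hj s t₀ hs
    · have h1 : |t - t₀| < P i := by
        rw [abs_lt]; constructor <;> linarith [ht.1, ht.2]
      have h2 := hγ.eq_of_apply_eq h1 hte
      linarith [ht.1]
  set U : Set Plane := {q | inner ℝ (γ i a) τ < inner ℝ q τ} ∩ {q | inner ℝ q τ < inner ℝ (γ i b) τ} ∩
    {q | |inner ℝ (q - γ i t₀) (perp τ)| < η} ∩ Cᶜ with hU
  have hUo : IsOpen U := by
    refine IsOpen.inter (IsOpen.inter (IsOpen.inter ?_ ?_) ?_) hCclosed.isOpen_compl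
    · exact isOpen_lt continuous_const (by fun_prop)
    · exact isOpen_lt (by fun_prop) continuous_const
    · exact isOpen_lt (by fun_prop) continuous_const
  have hat : a ∈ Icc a b := left_mem_Icc.2 hab
  have hbt : b ∈ Icc a b := right_mem_Icc.2 hab
  have ht₀ : t₀ ∈ Icc a b := ⟨by linarith, by linarith⟩
  refine ⟨U, hUo, ⟨⟨⟨hmono hat ht₀ (by linarith), hmono ht₀ hbt (by linarith)⟩, by
    simpa using hηpos⟩, hpC⟩, fun φ hφ hφU => ?_⟩
  have hφ0 : ∀ x, x ∉ U → φ x = 0 := fun x hx => image_eq_zero_of_notMem_tsupport fun h => hx (hφU h)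
  have hdiv0 : ∀ x, x ∉ U → divergence φ x = 0 := fun x hx =>
    divergence_eq_zero_of_notMem_tsupport fun h => hx (hφU h)
  have hinner : ∀ t w, inner ℝ (γ i t + w • perp τ) τ = inner ℝ (γ i t) τ := fun t w => by
    rw [inner_add_left, real_inner_smul_left, inner_perp_self, mul_zero, add_zero]
  have hout : ∀ t ∈ Icc a b, ∀ w, r ≤ |w| → γ i t + w • perp τ ∉ U := by
    rintro t ht w hw ⟨⟨_, h1⟩, _⟩
    have h1 : |inner ℝ (γ i t + w • perp τ - γ i t₀) (perp τ)| < η := h1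
    rw [add_sub_right_comm, inner_add_left, real_inner_smul_left, real_inner_self_eq_norm_sq,
      norm_perp, hτ] at h1
    have h2 : |inner ℝ (γ i t - γ i t₀) (perp τ)| ≤ η := by
      refine (abs_real_inner_le_norm _ _).trans ?_
      rw [norm_perp, hτ, mul_one]
      refine (hγ.norm_sub_le t t₀).trans ?_
      rw [abs_le]; constructor <;> linarith [ht.1, ht.2]
    have h3 : |w| ≤ |inner ℝ (γ i t - γ i t₀) (perp τ) + w * 1 ^ 2| +
        |inner ℝ (γ i t - γ i t₀) (perp τ)| := by
      have := abs_sub (inner ℝ (γ i t - γ i t₀) (perp τ) + w * 1 ^ 2)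
        (inner ℝ (γ i t - γ i t₀) (perp τ))
      simpa using this
    linarith
  have hdivI := integrable_divergence hφ
  set F : Plane → ℝ := Ω.indicator (divergence φ) with hF
  have hFi : Integrable F := hdivI.indicator₀ h.nullMeasurable
  have hFw : ∀ t ∈ Icc a b, ∫ w : ℝ, F (γ i t + w • perp τ) =
      ∫ w in (0 : ℝ)..r, divergence φ (γ i t + w • perp τ) := by
    intro t ht
    rw [intervalIntegral.integral_of_le hrpos.le, ← integral_indicator measurableSet_Ioc]
    refine integral_congr_ae ?_
    -- At `w = 0` the point is on the boundary, where membership in `Ω` is unspecified.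
    have hne : ∀ᵐ w : ℝ, w ≠ 0 := by
      simp [ae_iff]
    filter_upwards [hne] with w hw
    rcases le_or_gt r |w| with h1 | h1
    · have h2 := hdiv0 _ (hout t ht w h1)
      simp only [hF, indicator, h2, ite_self]
    · rcases lt_or_gt_of_ne hw with h2 | h2
      · have h3 := ((hsides t (hlt t ht)).2 (-w) (by linarith)
          (by rw [abs_of_neg h2] at h1; linarith)).2
        rw [neg_neg] at h3
        rw [hF, indicator_of_notMem h3, indicator_of_notMem fun hm => by linarith [hm.1]]
      · have h3 := ((hsides t (hlt t ht)).2 w h2 (by rw [abs_of_pos h2] at h1; linarith)).1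
        rw [abs_of_pos h2] at h1
        rw [hF, indicator_of_mem h3, indicator_of_mem (show w ∈ Ioc 0 r from ⟨h2, h1.le⟩)]
  have hlhs : ∫ x in Ω, divergence φ x =
      ∫ t in a..b, inner ℝ (φ (γ i t)) (-perp (deriv (γ i) t)) := by
    rw [← integral_indicator₀ h.nullMeasurable, integral_curve_coordinates hγ hτ hab hpos hFi]
    · rw [← integral_divergence_strip hγ hφ.1 hτ (r := r) (a := a) (b := b)]
      · refine intervalIntegral.integral_congr fun t ht => ?_
        rw [uIcc_of_le hab] at ht
        rw [hFw t ht, intervalIntegral.integral_const_mul]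
      · intro w
        refine hφ0 _ ?_
        rintro ⟨⟨⟨h1, _⟩, _⟩, _⟩
        have h1 : inner ℝ (γ i a) τ < inner ℝ (γ i a + w • perp τ) τ := h1
        rw [hinner] at h1; exact lt_irrefl _ h1
      · intro w
        refine hφ0 _ ?_
        rintro ⟨⟨⟨_, h1⟩, _⟩, _⟩
        have h1 : inner ℝ (γ i b + w • perp τ) τ < inner ℝ (γ i b) τ := h1
        rw [hinner] at h1; exact lt_irrefl _ h1
      · intro t ht
        rw [uIcc_of_le hab] at ht
        exact hφ0 _ (hout t ht r (le_abs_self r))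
    · intro x hx
      have hxU : x ∈ U := by
        by_contra hxU
        exact hx (by simp only [hF, indicator, hdiv0 x hxU, ite_self])
      exact ⟨(hxU.1.1.1 : _ < _).le, (hxU.1.1.2 : _ < _).le⟩
  have hzero : ∀ x ∈ C, φ x = 0 := fun x hx => hφ0 x fun hxU => hxU.2 hx
  rw [hlhs, Finset.sum_eq_single i]
  · set q : ℝ → ℝ := fun t => inner ℝ (φ (γ i t)) (-perp (deriv (γ i) t)) with hq
    have hqc : Continuous q :=
      (hφ.1.continuous.comp hγ.continuous).inner (continuous_perp.comp hγ.continuous_deriv).neg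
    have hper : Function.Periodic q (P i) := fun t => by
      simp only [hq, hγ.periodic t, hγ.periodic_deriv t]
    have h1 := hper.intervalIntegral_add_eq 0 a
    rw [zero_add] at h1
    rw [h1, ← intervalIntegral.integral_add_adjacent_intervals (hqc.intervalIntegrable a b)
      (hqc.intervalIntegrable b (a + P i))]
    rw [intervalIntegral.integral_congr (a := b) (g := fun _ => (0 : ℝ)) fun t ht => ?_]
    · simp
    · rw [uIcc_of_le (by linarith)] at ht
      simp only [hq]
      rw [hzero _ (Or.inr ⟨t, ht, rfl⟩), inner_zero_left]
  · intro j _ hj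
    rw [intervalIntegral.integral_congr (g := fun _ => (0 : ℝ)) fun t _ => ?_]
    · simp
    · dsimp only
      rw [hzero _ (Or.inl (mem_biUnion hj (mem_range_self t))), inner_zero_left]
  · simp

/-- The Gauss-Green formula. -/
theorem gaussGreen (h : IsBoundedBy Ω P γ) {φ : Plane → Plane} (hφ : IsTestField φ) :
    ∫ x in Ω, divergence φ x =
      ∑ j, ∫ t in (0 : ℝ)..P j, inner ℝ (φ (γ j t)) (-perp (deriv (γ j) t)) := by
  set Q : (Plane → Plane) → Prop := fun φ => IsTestField φ ∧ ∫ x in Ω, divergence φ x =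
      ∑ j, ∫ t in (0 : ℝ)..P j, inner ℝ (φ (γ j t)) (-perp (deriv (γ j) t)) with hQ
  have hloc : ∀ x : Plane, ∃ U : Set Plane, IsOpen U ∧ x ∈ U ∧
      ∀ φ, IsTestField φ → tsupport φ ⊆ U → Q φ := by
    intro x
    by_cases hx : x ∈ frontier Ω
    · rw [h.frontier_eq, mem_iUnion] at hx
      obtain ⟨i, t, rfl⟩ := hx
      obtain ⟨U, h1, h2, h3⟩ := h.gaussGreen_local i t
      exact ⟨U, h1, h2, fun φ hφ hU => ⟨hφ, h3 φ hφ hU⟩⟩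
    -- Away from the boundary both sides vanish: in the interior because a test field has zero total
    -- divergence, in the exterior because the field does not meet `Ω`.
    · have hbd : ∀ φ : Plane → Plane, tsupport φ ⊆ (frontier Ω)ᶜ →
          ∑ j, ∫ t in (0 : ℝ)..P j, inner ℝ (φ (γ j t)) (-perp (deriv (γ j) t)) = 0 := by
        intro φ hφ
        refine Finset.sum_eq_zero fun j _ => ?_
        rw [intervalIntegral.integral_congr (g := fun _ => (0 : ℝ)) fun t _ => ?_]
        · simp
        · have := image_eq_zero_of_notMem_tsupport fun hm => hφ hm (h.mem_frontier j t)
          simp [this]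
      by_cases hxc : x ∈ closure Ω
      · refine ⟨interior Ω, isOpen_interior, by by_contra hxi; exact hx ⟨hxc, hxi⟩,
          fun φ hφ hU => ⟨hφ, ?_⟩⟩
        rw [hbd φ (hU.trans fun y hy hyf => hyf.2 hy),
          setIntegral_eq_integral_of_forall_compl_eq_zero, integral_divergence_eq_zero hφ]
        exact fun y hy => divergence_eq_zero_of_notMem_tsupport fun hm =>
          hy (interior_subset (hU hm))
      · refine ⟨(closure Ω)ᶜ, isClosed_closure.isOpen_compl, hxc, fun φ hφ hU => ⟨hφ, ?_⟩⟩
        rw [hbd φ (hU.trans fun y hy hyf => hy hyf.1), ← integral_indicator₀ h.nullMeasurable]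
        refine integral_eq_zero_of_ae (Eventually.of_forall fun y => ?_)
        by_cases hy : y ∈ Ω
        · rw [indicator_of_mem hy]
          exact divergence_eq_zero_of_notMem_tsupport fun hm => hU hm (subset_closure hy)
        · exact indicator_of_notMem hy _
  have hadd : ∀ φ ψ, Q φ → Q ψ → Q (φ + ψ) := by
    rintro φ ψ ⟨hφ, hφe⟩ ⟨hψ, hψe⟩
    refine ⟨⟨hφ.1.add hψ.1, hφ.2.add hψ.2⟩, ?_⟩
    have h1 : divergence (φ + ψ) = fun x => divergence φ x + divergence ψ x := by
      ext x
      exact divergence_add (hφ.1.differentiable one_ne_zero x) (hψ.1.differentiable one_ne_zero x)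
    rw [h1, integral_add (integrable_divergence hφ).integrableOn
      (integrable_divergence hψ).integrableOn, hφe, hψe, ← Finset.sum_add_distrib]
    refine Finset.sum_congr rfl fun j _ => ?_
    have hc : ∀ {χ : Plane → Plane}, IsTestField χ → IntervalIntegrable
        (fun t => inner ℝ (χ (γ j t)) (-perp (deriv (γ j) t))) volume 0 (P j) := fun hχ =>
      ((hχ.1.continuous.comp (h.curve j).continuous).inner
        (continuous_perp.comp (h.curve j).continuous_deriv).neg).intervalIntegrable _ _
    rw [← intervalIntegral.integral_add (hc hφ) (hc hψ)]
    simp only [Pi.add_apply, inner_add_left]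
  have hzero : Q 0 := by
    refine ⟨⟨contDiff_const, HasCompactSupport.zero⟩, ?_⟩
    have : divergence (0 : Plane → Plane) = fun _ => 0 := by
      ext x; simp [divergence]
    simp [this]
  choose U hUo hxU hUQ using hloc
  -- Compact support leaves finitely many neighbourhoods, so the partition of unity writes `φ` as a
  -- finite sum of local fields.
  obtain ⟨s, hs⟩ := hφ.2.elim_finite_subcover U hUo fun x _ => mem_iUnion_of_mem x (hxU x)
  obtain ⟨f, hf⟩ := SmoothPartitionOfUnity.exists_isSubordinate
    (modelWithCornersSelf ℝ Plane) (isClosed_tsupport φ) (fun x : s => U x) (fun x => hUo x)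
    (by simpa [iUnion_subtype] using hs)
  have hφs : φ = ∑ k : s, fun x => f k x • φ x := by
    ext1 x
    rw [Finset.sum_apply, ← Finset.sum_smul]
    by_cases hx : x ∈ tsupport φ
    · have := f.sum_eq_one hx
      rw [finsum_eq_sum_of_fintype] at this
      rw [this, one_smul]
    · rw [image_eq_zero_of_notMem_tsupport hx, smul_zero]
  have : Q φ := by
    rw [hφs]
    refine Finset.sum_induction _ Q hadd hzero fun k _ => ?_
    refine hUQ k _ (hφ.smul ((f k).contMDiff.contDiff.of_le (by exact_mod_cast le_top))) ?_
    exact (tsupport_smul_subset_left (f k) φ).trans (hf k)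
  exact this.2

end IsBoundedBy

/-! ### Uniqueness of the Gauss-Green measure -/

/-- `n` is a unit vector only `σ`-almost everywhere, but on the rest the density of `σ` vanishes
`τ`-almost everywhere. Thus the density can be recovered as the norm of the vector density. -/
lemma IsGaussGreen.ae_norm_rnDeriv_smul {Ω : Set Plane} {σ τ : Measure Plane} {n : Plane → Plane}
    (h : IsGaussGreen Ω σ n) [SigmaFinite σ] [SigmaFinite τ] (hle : σ ≤ τ) :
    ∀ᵐ x ∂τ, ‖(σ.rnDeriv τ x).toReal • n x‖ = (σ.rnDeriv τ x).toReal ∧ σ.rnDeriv τ x ≤ 1 := by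
  have hac : σ ≪ τ := Measure.absolutelyContinuous_of_le hle
  have h1 := h.norm_eq_one
  rw [← Measure.withDensity_rnDeriv_eq σ τ hac,
    ae_withDensity_iff (Measure.measurable_rnDeriv σ τ)] at h1
  filter_upwards [h1, Measure.rnDeriv_le_one_of_le hle] with x hx hx1
  refine ⟨?_, hx1⟩
  by_cases h0 : σ.rnDeriv τ x = 0
  · simp [h0]
  · rw [norm_smul, hx h0, mul_one, Real.norm_eq_abs, abs_of_nonneg ENNReal.toReal_nonneg]

lemma IsGaussGreen.locallyIntegrable {Ω : Set Plane} {σ τ : Measure Plane} {n : Plane → Plane}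
    (h : IsGaussGreen Ω σ n) [SigmaFinite σ] [SigmaFinite τ] [IsLocallyFiniteMeasure τ]
    (hle : σ ≤ τ) (i : Fin 2) :
    LocallyIntegrable (fun x => (σ.rnDeriv τ x).toReal * n x i) τ := by
  refine (locallyIntegrable_const (1 : ℝ)).mono ?_ ?_
  · have h1 : Measurable fun x => n x i :=
      (EuclideanSpace.proj (𝕜 := ℝ) i).continuous.measurable.comp h.measurable
    exact ((Measure.measurable_rnDeriv σ τ).ennreal_toReal.mul h1).aestronglyMeasurable
  · filter_upwards [h.ae_norm_rnDeriv_smul hle] with x ⟨hx, hx1⟩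
    have h2 : ‖((σ.rnDeriv τ x).toReal • n x) i‖ ≤ ‖(σ.rnDeriv τ x).toReal • n x‖ :=
      PiLp.norm_apply_le _ i
    rw [hx] at h2
    have h3 : (σ.rnDeriv τ x).toReal ≤ 1 := ENNReal.toReal_le_of_le_ofReal zero_le_one (by simpa)
    simpa using h2.trans h3

lemma IsGaussGreen.integral_smul_rnDeriv {Ω : Set Plane} {σ τ : Measure Plane} {n : Plane → Plane}
    (h : IsGaussGreen Ω σ n) [SigmaFinite σ] [SigmaFinite τ] (hle : σ ≤ τ) (i : Fin 2)
    {g : Plane → ℝ} (hg : ContDiff ℝ 1 g) (hgs : HasCompactSupport g) :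
    ∫ x, g x • ((σ.rnDeriv τ x).toReal * n x i) ∂τ =
      ∫ x in Ω, divergence (fun y => g y • EuclideanSpace.single i (1 : ℝ)) x := by
  have hac : σ ≪ τ := Measure.absolutelyContinuous_of_le hle
  rw [h.gauss_green (fun y => g y • EuclideanSpace.single i (1 : ℝ)) ⟨hg.smul contDiff_const, hgs.mono fun x hx h0 => hx (by simp [h0])⟩,
    ← integral_rnDeriv_smul hac]
  refine integral_congr_ae (Eventually.of_forall fun x => ?_)
  simp only [smul_eq_mul, real_inner_smul_left, EuclideanSpace.inner_single_left, map_one, one_mul]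
  ring

/-- The Gauss-Green measure and its polar decomposition are unique. -/
theorem IsGaussGreen.unique {Ω : Set Plane} {σ σ' : Measure Plane} {n n' : Plane → Plane}
    (h : IsGaussGreen Ω σ n) (h' : IsGaussGreen Ω σ' n') : σ = σ' ∧ n =ᵐ[σ] n' := by
  have := h.locallyFinite
  have := h'.locallyFinite
  -- A common dominating measure. Both vector densities have the same integrals against test
  -- functions, so they agree; taking norms gives equal scalar densities, and dividing gives equal
  -- directions.
  set τ := σ + σ' with hτ
  have : IsLocallyFiniteMeasure τ := ⟨fun x => by
    obtain ⟨s, hs, hsσ⟩ := σ.finiteAt_nhds x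
    obtain ⟨s', hs', hsσ'⟩ := σ'.finiteAt_nhds x
    refine ⟨s ∩ s', inter_mem hs hs', ?_⟩
    rw [hτ, Measure.add_apply]
    exact ENNReal.add_lt_top.2 ⟨(measure_mono inter_subset_left).trans_lt hsσ,
      (measure_mono inter_subset_right).trans_lt hsσ'⟩⟩
  have hle : σ ≤ τ := Measure.le_add_right le_rfl
  have hle' : σ' ≤ τ := Measure.le_add_left le_rfl
  have hac : σ ≪ τ := Measure.absolutelyContinuous_of_le hle
  have hac' : σ' ≪ τ := Measure.absolutelyContinuous_of_le hle'
  have hcoord : ∀ i, ∀ᵐ x ∂τ,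
      (σ.rnDeriv τ x).toReal * n x i = (σ'.rnDeriv τ x).toReal * n' x i := fun i =>
    ae_eq_of_integral_contDiff_smul_eq (h.locallyIntegrable hle i) (h'.locallyIntegrable hle' i)
      fun g hg hgs => by
        have hg1 : ContDiff ℝ 1 g := hg.of_le (by exact_mod_cast le_top)
        rw [h.integral_smul_rnDeriv hle i hg1 hgs, h'.integral_smul_rnDeriv hle' i hg1 hgs]
  have hvec : ∀ᵐ x ∂τ, (σ.rnDeriv τ x).toReal • n x = (σ'.rnDeriv τ x).toReal • n' x := by
    filter_upwards [hcoord 0, hcoord 1] with x h0 h1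
    exact plane_ext (by simpa using h0) (by simpa using h1)
  have hrn : σ.rnDeriv τ =ᵐ[τ] σ'.rnDeriv τ := by
    filter_upwards [hvec, h.ae_norm_rnDeriv_smul hle, h'.ae_norm_rnDeriv_smul hle'] with x hx h1 h2
    have h3 := congrArg norm hx
    rw [h1.1, h2.1] at h3
    exact (ENNReal.toReal_eq_toReal_iff' (ne_top_of_le_ne_top ENNReal.one_ne_top h1.2)
      (ne_top_of_le_ne_top ENNReal.one_ne_top h2.2)).1 h3
  refine ⟨?_, ?_⟩
  · rw [← Measure.withDensity_rnDeriv_eq σ τ hac, ← Measure.withDensity_rnDeriv_eq σ' τ hac',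
      withDensity_congr_ae hrn]
  · filter_upwards [hac.ae_le hvec, hac.ae_le hrn, hac.ae_le (h.ae_norm_rnDeriv_smul hle),
      Measure.rnDeriv_pos hac] with x h1 h2 h3 h4
    rw [← h2] at h1
    exact smul_right_injective Plane (ENNReal.toReal_pos h4.ne'
      (ne_top_of_le_ne_top ENNReal.one_ne_top h3.2)).ne' h1

lemma tendsto_ball_average {σ : Measure Plane} [IsFiniteMeasure σ] {n : Plane → Plane}
    (hn : Continuous n) {C : ℝ} (hC : ∀ x, ‖n x‖ ≤ C) {y : Plane}
    (hy : ∀ r : ℝ, 0 < r → 0 < σ (Metric.ball y r)) :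
    Tendsto (fun r : ℝ => (σ.real (Metric.ball y r))⁻¹ • ∫ x in Metric.ball y r, n x ∂σ)
      (𝓝[>] 0) (𝓝 (n y)) := by
  have hint : Integrable n σ := Integrable.of_bound hn.aestronglyMeasurable C
    (Eventually.of_forall hC)
  rw [Metric.tendsto_nhds]
  intro ε hε
  obtain ⟨δ, hδ, hδn⟩ := Metric.continuousAt_iff.1 hn.continuousAt (ε / 2) (half_pos hε)
  filter_upwards [Ioo_mem_nhdsGT hδ] with r hr
  have hpos : 0 < σ.real (Metric.ball y r) :=
    ENNReal.toReal_pos (hy r hr.1).ne' (measure_ne_top _ _)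
  have h1 : (σ.real (Metric.ball y r))⁻¹ • ∫ x in Metric.ball y r, n x ∂σ - n y =
      (σ.real (Metric.ball y r))⁻¹ • ∫ x in Metric.ball y r, (n x - n y) ∂σ := by
    rw [integral_sub hint.integrableOn (integrable_const _), setIntegral_const, smul_sub, smul_smul,
      inv_mul_cancel₀ hpos.ne', one_smul]
  rw [dist_eq_norm, h1, norm_smul, norm_inv, Real.norm_eq_abs, abs_of_pos hpos, inv_mul_eq_div,
    div_lt_iff₀ hpos]
  have h2 : ‖∫ x in Metric.ball y r, (n x - n y) ∂σ‖ ≤ ε / 2 * σ.real (Metric.ball y r) := by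
    refine norm_setIntegral_le_of_norm_le_const (measure_lt_top _ _) fun x hx => ?_
    have := hδn (x := x) (lt_trans hx hr.2)
    rw [dist_eq_norm] at this
    exact this.le
  nlinarith

/-! ### Reduced boundary, outer normal and perimeter of a domain bounded by curves -/

namespace IsBoundedBy

variable {Ω : Set Plane} {N : ℕ} {P : Fin N → ℝ} {γ : Fin N → ℝ → Plane}

lemma restrict_frontier (h : IsBoundedBy Ω P γ) :
    (μH[1] : Measure Plane).restrict (frontier Ω) =
      ∑ i, (volume.restrict (Ico 0 (P i))).map (γ i) := by
  rw [h.frontier_eq, Measure.restrict_iUnion (fun i j hij => h.disjoint_range i j hij)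
    (fun i => (h.curve i).isCompact_range.measurableSet), Measure.sum_fintype]
  exact Finset.sum_congr rfl fun i _ => (h.curve i).restrict_hausdorffMeasure

lemma lintegral_frontier (h : IsBoundedBy Ω P γ) (f : Plane → ℝ≥0∞) :
    ∫⁻ y in frontier Ω, f y ∂(μH[1] : Measure Plane) = ∑ i, ∫⁻ t in Ico 0 (P i), f (γ i t) := by
  rw [h.restrict_frontier, lintegral_finsetSum_measure]
  exact Finset.sum_congr rfl fun i _ => (h.curve i).lintegral_map f

lemma integral_frontier (h : IsBoundedBy Ω P γ) {f : Plane → ℝ}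
    (hf : ∀ i, IntegrableOn (fun t => f (γ i t)) (Ico 0 (P i))) :
    ∫ y in frontier Ω, f y ∂(μH[1] : Measure Plane) = ∑ i, ∫ t in (0 : ℝ)..P i, f (γ i t) := by
  rw [h.restrict_frontier, integral_finsetSum_measure fun i _ =>
    ((h.curve i).integrable_map_iff f).2 (hf i)]
  refine Finset.sum_congr rfl fun i _ => ?_
  rw [(h.curve i).integral_map f, intervalIntegral.integral_of_le (h.curve i).length_pos.le,
    integral_Ico_eq_integral_Ioc]

lemma isFiniteMeasure_restrict_frontier (h : IsBoundedBy Ω P γ) :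
    IsFiniteMeasure ((μH[1] : Measure Plane).restrict (frontier Ω)) := by
  rw [h.restrict_frontier]
  infer_instance

lemma isGaussGreen (h : IsBoundedBy Ω P γ) {n₀ : Plane → Plane} (hn₀ : IsTestField n₀)
    (hnormal : ∀ i t, n₀ (γ i t) = -perp (deriv (γ i) t)) :
    IsGaussGreen Ω ((μH[1] : Measure Plane).restrict (frontier Ω)) n₀ := by
  have := h.isFiniteMeasure_restrict_frontier
  refine ⟨inferInstance, hn₀.1.continuous.measurable, ?_, fun φ hφ => ?_⟩
  · filter_upwards [ae_restrict_mem isClosed_frontier.measurableSet] with x hx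
    rw [h.frontier_eq, mem_iUnion] at hx
    obtain ⟨i, t, rfl⟩ := hx
    rw [hnormal, norm_neg, norm_perp, (h.curve i).arcLength]
  · rw [h.gaussGreen hφ, h.integral_frontier]
    · simp only [hnormal]
    · intro i
      have hc : Continuous fun t => inner ℝ (φ (γ i t)) (n₀ (γ i t)) :=
        (hφ.1.continuous.comp (h.curve i).continuous).inner
          (hn₀.1.continuous.comp (h.curve i).continuous)
      exact (hc.continuousOn.integrableOn_compact isCompact_Icc).mono_set Ico_subset_Icc_self

lemma measure_ball_pos (h : IsBoundedBy Ω P γ) {y : Plane} (hy : y ∈ frontier Ω) {r : ℝ}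
    (hr : 0 < r) : 0 < (μH[1] : Measure Plane).restrict (frontier Ω) (Metric.ball y r) := by
  rw [h.frontier_eq, mem_iUnion] at hy
  obtain ⟨i, hy⟩ := hy
  have hγ := h.curve i
  rw [hγ.range_eq_image_Ico] at hy
  obtain ⟨t, ht, rfl⟩ := hy
  rw [h.restrict_frontier, Measure.finsetSum_apply]
  refine lt_of_lt_of_le ?_ (Finset.single_le_sum (fun j _ => zero_le) (Finset.mem_univ i))
  rw [Measure.map_apply hγ.continuous.measurable Metric.isOpen_ball.measurableSet,
    Measure.restrict_apply (hγ.continuous.measurable Metric.isOpen_ball.measurableSet)]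
  have hsub : Ico t (min (t + r) (P i)) ⊆ γ i ⁻¹' Metric.ball (γ i t) r ∩ Ico 0 (P i) := by
    intro s hs
    have h1 := hs.2.trans_le (min_le_left _ _)
    refine ⟨?_, ht.1.trans hs.1, hs.2.trans_le (min_le_right _ _)⟩
    rw [mem_preimage, Metric.mem_ball, dist_eq_norm]
    refine (hγ.norm_sub_le s t).trans_lt ?_
    rw [abs_of_nonneg (sub_nonneg.2 hs.1)]; linarith
  refine lt_of_lt_of_le ?_ (measure_mono hsub)
  rw [Real.volume_Ico, ENNReal.ofReal_pos, sub_pos]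
  exact lt_min (by linarith) ht.2

/-- Uniqueness leaves `H¹` on the frontier as the only candidate measure. Its support is the
frontier, and the ball averages of the continuous field `n₀` converge to its value at every point.
-/
lemma hasOuterNormal_iff (h : IsBoundedBy Ω P γ) {n₀ : Plane → Plane} (hn₀ : IsTestField n₀)
    (hle : ∀ x, ‖n₀ x‖ ≤ 1) (hnormal : ∀ i t, n₀ (γ i t) = -perp (deriv (γ i) t)) {y v : Plane} :
    HasOuterNormal Ω y v ↔ y ∈ frontier Ω ∧ v = n₀ y := by
  have hfin := h.isFiniteMeasure_restrict_frontier
  have hGG := h.isGaussGreen hn₀ hnormal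
  constructor
  · rintro ⟨-, σ, n, hσ, hpos, hlim⟩
    obtain ⟨rfl, hn⟩ := hGG.unique hσ
    have hy : y ∈ frontier Ω := by
      by_contra hy
      obtain ⟨r, hr, hball⟩ := Metric.isOpen_iff.1 isClosed_frontier.isOpen_compl y hy
      refine (hpos r hr).ne' ?_
      rw [Measure.restrict_apply Metric.isOpen_ball.measurableSet,
        (disjoint_compl_left_iff_subset.2 subset_rfl |>.mono_left hball).inter_eq, measure_empty]
    refine ⟨hy, tendsto_nhds_unique hlim ?_⟩
    refine (tendsto_ball_average hn₀.1.continuous hle hpos).congr fun r => ?_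
    congr 1
    exact integral_congr_ae (ae_restrict_of_ae hn)
  · rintro ⟨hy, rfl⟩
    refine ⟨?_, _, n₀, hGG, fun r hr => h.measure_ball_pos hy hr,
      tendsto_ball_average hn₀.1.continuous hle fun r hr => h.measure_ball_pos hy hr⟩
    rw [h.frontier_eq, mem_iUnion] at hy
    obtain ⟨i, t, rfl⟩ := hy
    rw [hnormal, norm_neg, norm_perp, (h.curve i).arcLength]

theorem reducedBoundary_eq (h : IsBoundedBy Ω P γ) : reducedBoundary Ω = frontier Ω := by
  obtain ⟨n₀, hn₀, hle, hnormal⟩ := h.exists_normal_extension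
  ext y
  simp [reducedBoundary, h.hasOuterNormal_iff hn₀ hle hnormal]

theorem outerNormal_curve (h : IsBoundedBy Ω P γ) (i : Fin N) (t : ℝ) :
    outerNormal Ω (γ i t) = -perp (deriv (γ i) t) := by
  obtain ⟨n₀, hn₀, hle, hnormal⟩ := h.exists_normal_extension
  have hex : ∃ v, HasOuterNormal Ω (γ i t) v :=
    ⟨_, (h.hasOuterNormal_iff hn₀ hle hnormal).2 ⟨h.mem_frontier i t, rfl⟩⟩
  rw [outerNormal, dif_pos hex, ((h.hasOuterNormal_iff hn₀ hle hnormal).1 hex.choose_spec).2,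
    hnormal]

/-- By Gauss-Green and Cauchy-Schwarz no admissible field exceeds the total length, and the extended
normal attains it. -/
theorem perimeter_eq (h : IsBoundedBy Ω P γ) : perimeter Ω = ENNReal.ofReal (∑ i, P i) := by
  refine le_antisymm (iSup₂_le fun φ hφ => ?_) ?_
  · refine ENNReal.ofReal_le_ofReal ?_
    rw [h.gaussGreen hφ.1]
    refine Finset.sum_le_sum fun i _ => ?_
    refine (le_abs_self _).trans ?_
    have := intervalIntegral.norm_integral_le_of_norm_le_const (a := 0) (b := P i) (C := 1)
      (f := fun t => inner ℝ (φ (γ i t)) (-perp (deriv (γ i) t))) fun t _ => by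
        refine (norm_inner_le_norm _ _).trans ?_
        rw [norm_neg, norm_perp, (h.curve i).arcLength, mul_one]
        exact hφ.2 _
    rwa [sub_zero, abs_of_pos (h.curve i).length_pos, one_mul] at this
  · obtain ⟨n₀, hn₀, hle, hnormal⟩ := h.exists_normal_extension
    refine le_iSup₂_of_le n₀ ⟨hn₀, hle⟩ (ENNReal.ofReal_le_ofReal ?_)
    rw [h.gaussGreen hn₀]
    refine Finset.sum_le_sum fun i _ => ?_
    simp [hnormal, (h.curve i).arcLength]

end IsBoundedBy

/-! ### The regularized dipole kernel -/

/-- The regularized norm `√(|v|² + ε²)`. -/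
def softNorm (ε : ℝ) (v : Plane) : ℝ := √(‖v‖ ^ 2 + ε ^ 2)

/-- The regularized dipole kernel `ν · (x - y) / (|x - y|² + ε²)^{3/2}`. -/
def softKernel (ν y : Plane) (ε : ℝ) (x : Plane) : ℝ :=
  inner ℝ ν (x - y) / softNorm ε (x - y) ^ 3

lemma softNorm_zero (v : Plane) : softNorm 0 v = ‖v‖ := by
  simp [softNorm]

lemma softNorm_nonneg (ε : ℝ) (v : Plane) : 0 ≤ softNorm ε v := Real.sqrt_nonneg _

lemma softNorm_pos {ε : ℝ} (hε : 0 < ε) (v : Plane) : 0 < softNorm ε v := by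
  unfold softNorm; positivity

lemma norm_le_softNorm (ε : ℝ) (v : Plane) : ‖v‖ ≤ softNorm ε v :=
  Real.le_sqrt_of_sq_le (by nlinarith [sq_nonneg ε])

lemma softNorm_mono {ε ε' : ℝ} (hε : 0 ≤ ε) (h : ε ≤ ε') (v : Plane) :
    softNorm ε v ≤ softNorm ε' v := by
  unfold softNorm; gcongr

@[fun_prop] lemma continuous_softNorm_right (ε : ℝ) : Continuous (softNorm ε) := by
  unfold softNorm; fun_prop

lemma tendsto_softNorm {α : Type*} {l : Filter α} {e : α → ℝ} (he : Tendsto e l (𝓝 0)) (v : Plane) :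
    Tendsto (fun k => softNorm (e k) v) l (𝓝 ‖v‖) := by
  have hc : Continuous fun ε : ℝ => softNorm ε v := by unfold softNorm; fun_prop
  simpa [softNorm_zero, Function.comp_def] using (hc.tendsto 0).comp he

lemma continuous_softKernel (ν y : Plane) {ε : ℝ} (hε : 0 < ε) :
    Continuous (softKernel ν y ε) := by
  unfold softKernel
  refine Continuous.div (by fun_prop) (by fun_prop) fun x => (pow_pos (softNorm_pos hε _) 3).ne'

lemma measurable_softKernel (ν y : Plane) (ε : ℝ) : Measurable (softKernel ν y ε) := by
  unfold softKernel
  exact (by fun_prop : Continuous fun x : Plane => inner ℝ ν (x - y)).measurable.div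
    (by fun_prop : Continuous fun x : Plane => softNorm ε (x - y) ^ 3).measurable

lemma abs_softKernel (ν y : Plane) (ε : ℝ) (x : Plane) :
    |softKernel ν y ε x| = |inner ℝ ν (x - y)| / softNorm ε (x - y) ^ 3 := by
  rw [softKernel, abs_div, abs_of_nonneg (pow_nonneg (softNorm_nonneg _ _) 3)]

lemma abs_softKernel_anti (ν y : Plane) {ε ε' : ℝ} (hε : 0 ≤ ε) (h : ε ≤ ε') (x : Plane) :
    |softKernel ν y ε' x| ≤ |softKernel ν y ε x| := by
  rw [abs_softKernel, abs_softKernel]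
  rcases eq_or_ne x y with rfl | hxy
  · simp
  · have h1 : 0 < softNorm ε (x - y) :=
      (norm_pos_iff.2 (sub_ne_zero.2 hxy)).trans_le (norm_le_softNorm _ _)
    have h2 := softNorm_mono hε h (x - y)
    gcongr

lemma tendsto_softKernel {α : Type*} {l : Filter α} {e : α → ℝ} (he : Tendsto e l (𝓝 0))
    (ν y x : Plane) : Tendsto (fun k => softKernel ν y (e k) x) l
      (𝓝 (inner ℝ ν (x - y) / ‖x - y‖ ^ 3)) := by
  unfold softKernel
  rcases eq_or_ne x y with rfl | hxy
  · simpa using tendsto_const_nhds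
  · exact tendsto_const_nhds.div ((tendsto_softNorm he (x - y)).pow 3)
      (pow_ne_zero _ (norm_ne_zero_iff.2 (sub_ne_zero.2 hxy)))

lemma abs_softKernel_le_one {ν y x : Plane} (hν : ‖ν‖ = 1) (hx : 1 ≤ ‖x - y‖) (ε : ℝ) :
    |softKernel ν y ε x| ≤ 1 := by
  have h1 : |inner ℝ ν (x - y)| ≤ ‖x - y‖ := by simpa [hν] using abs_real_inner_le_norm ν (x - y)
  have h2 := norm_le_softNorm ε (x - y)
  have h3 : 1 ≤ softNorm ε (x - y) := hx.trans h2
  rw [abs_softKernel, div_le_one (by positivity)]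
  calc |inner ℝ ν (x - y)| ≤ softNorm ε (x - y) := h1.trans h2
    _ ≤ softNorm ε (x - y) ^ 3 := le_self_pow₀ h3 (by norm_num)

lemma integrableOn_softKernel (ν y : Plane) {ε : ℝ} (hε : 0 < ε) {s : Set Plane}
    (hs : Bornology.IsBounded s) : IntegrableOn (softKernel ν y ε) s := by
  obtain ⟨R, hR⟩ := hs.subset_closedBall (0 : Plane)
  exact ((continuous_softKernel ν y hε).continuousOn.integrableOn_compact
    (isCompact_closedBall 0 R)).mono_set hR

/-! ### The regularized kernel as a divergence -/

lemma divergence_smul_const {g : Plane → ℝ} {x : Plane} (hg : DifferentiableAt ℝ g x) (v : Plane) :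
    divergence (fun y => g y • v) x = fderiv ℝ g x v := by
  have h1 : fderiv ℝ (fun y => g y • v) x = (fderiv ℝ g x).smulRight v :=
    (hg.hasFDerivAt.smul_const v).fderiv
  have h2 : v = v 0 • EuclideanSpace.single 0 1 + v 1 • EuclideanSpace.single 1 1 := by
    refine plane_ext ?_ ?_ <;> simp
  conv_rhs => rw [h2, map_add, map_smul, map_smul]
  simp only [divergence, h1, Fin.sum_univ_two, ContinuousLinearMap.smulRight_apply,
    PiLp.smul_apply, smul_eq_mul]
  ring

lemma contDiff_inv_softNorm (y : Plane) {ε : ℝ} (hε : 0 < ε) :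
    ContDiff ℝ 1 fun x => (softNorm ε (x - y))⁻¹ := by
  refine ContDiff.inv ?_ fun x => (softNorm_pos hε _).ne'
  unfold softNorm
  refine ContDiff.sqrt (((contDiff_id.sub contDiff_const).norm_sq ℝ).add contDiff_const)
    fun x => ?_
  have : 0 < ε ^ 2 := by positivity
  positivity

lemma fderiv_inv_softNorm (y x v : Plane) {ε : ℝ} (hε : 0 < ε) :
    fderiv ℝ (fun x => (softNorm ε (x - y))⁻¹) x v = -softKernel v y ε x := by
  have hpos := softNorm_pos hε (x - y)
  have h1 : HasDerivAt (fun s : ℝ => x + s • v) v 0 := by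
    simpa using ((hasDerivAt_id (0 : ℝ)).smul_const v).const_add x
  have h2 := HasFDerivAt.comp_hasDerivAt (f := fun s : ℝ => x + s • v) 0 (by
    simpa using ((contDiff_inv_softNorm y hε).differentiable one_ne_zero x).hasFDerivAt) h1
  have h3 : HasDerivAt (fun s : ℝ => ‖x + s • v - y‖ ^ 2 + ε ^ 2) (2 * inner ℝ (x - y) v) 0 := by
    simpa using ((h1.sub_const y).norm_sq).add_const (ε ^ 2)
  have h4 := (h3.sqrt (by simp only [zero_smul, add_zero]; positivity)).inv (by
    simp only [zero_smul, add_zero]; exact hpos.ne')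
  have h5 := h2.unique h4
  rw [h5]
  simp only [zero_smul, add_zero]
  change -(2 * inner ℝ (x - y) v / (2 * softNorm ε (x - y))) / softNorm ε (x - y) ^ 2 = _
  rw [softKernel, real_inner_comm v]
  field_simp

/-- The Gauss-Green formula for the regularized kernel. -/
lemma IsBoundedBy.integral_softKernel {Ω : Set Plane} {N : ℕ} {P : Fin N → ℝ}
    {γ : Fin N → ℝ → Plane} (h : IsBoundedBy Ω P γ) (ν y : Plane) {ε : ℝ} (hε : 0 < ε) :
    ∫ x in Ω, softKernel ν y ε x =
      ∑ j, ∫ s in (0 : ℝ)..P j, inner ℝ (perp (deriv (γ j) s)) ν / softNorm ε (γ j s - y) := by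
  obtain ⟨R, hR⟩ := (h.isBounded.closure).subset_ball (0 : Plane)
  -- The cutoff provides compact support and equals `1` near the closure of `Ω`, so it affects
  -- neither the area integral nor the boundary terms.
  set χ : ContDiffBump (0 : Plane) := ⟨max R 1, max R 1 + 1, by positivity, by linarith⟩
  have hone : ∀ x ∈ closure Ω, ∀ᶠ z in 𝓝 x, χ z = 1 := fun x hx => by
    filter_upwards [Metric.isOpen_ball.mem_nhds (hR hx)] with z hz
    refine χ.one_of_mem_closedBall (Metric.ball_subset_closedBall ?_)
    exact Metric.ball_subset_ball (le_max_left _ _) hz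
  set φ : Plane → Plane := fun x => (χ x * (softNorm ε (x - y))⁻¹) • ν with hφ
  have hcd : ContDiff ℝ 1 fun x => χ x * (softNorm ε (x - y))⁻¹ :=
    χ.contDiff.mul (contDiff_inv_softNorm y hε)
  have hφt : IsTestField φ := ⟨hcd.smul contDiff_const,
    χ.hasCompactSupport.mono fun x hx h0 => hx (by simp [hφ, h0])⟩
  have hdiv : ∀ x ∈ closure Ω, divergence φ x = -softKernel ν y ε x := by
    intro x hx
    rw [hφ, divergence_smul_const (hcd.differentiable one_ne_zero x), ← fderiv_inv_softNorm y x ν hε]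
    congr 1
    refine Filter.EventuallyEq.fderiv_eq ?_
    filter_upwards [hone x hx] with z hz
    rw [hz, one_mul]
  have h1 := h.gaussGreen hφt
  have h2 : ∫ x in Ω, divergence φ x = -∫ x in Ω, softKernel ν y ε x := by
    rw [← integral_neg, ← integral_indicator₀ h.nullMeasurable,
      ← integral_indicator₀ h.nullMeasurable]
    refine integral_congr_ae (Eventually.of_forall fun x => ?_)
    by_cases hx : x ∈ Ω
    · simp only [indicator_of_mem hx, hdiv x (subset_closure hx)]
    · simp only [indicator_of_notMem hx]
  rw [h2, neg_eq_iff_eq_neg, ← Finset.sum_neg_distrib] at h1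
  rw [h1]
  refine Finset.sum_congr rfl fun j _ => ?_
  rw [← intervalIntegral.integral_neg]
  refine intervalIntegral.integral_congr fun s _ => ?_
  have h3 := (hone (γ j s) (h.mem_frontier j s).1).self_of_nhds
  simp only [hφ, h3, one_mul, inner_neg_right, neg_neg, real_inner_smul_left]
  rw [real_inner_comm ν, div_eq_inv_mul]

/-! ### The half disk -/

lemma hasDerivAt_arsinh_div {ε : ℝ} (hε : 0 < ε) (u : ℝ) :
    HasDerivAt (fun u => Real.arsinh (u / ε)) (1 / √(u ^ 2 + ε ^ 2)) u := by
  have h1 := ((hasDerivAt_id u).div_const ε).arsinh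
  refine h1.congr_deriv ?_
  have h2 : √(u ^ 2 + ε ^ 2) = ε * √(1 + (u / ε) ^ 2) := by
    rw [show u ^ 2 + ε ^ 2 = ε ^ 2 * (1 + (u / ε) ^ 2) by field_simp; ring,
      Real.sqrt_mul (by positivity), Real.sqrt_sq hε.le]
  rw [h2]
  have : 0 < √(1 + (u / ε) ^ 2) := by positivity
  simp only [id_eq, smul_eq_mul]
  field_simp

lemma continuous_inv_sqrt {ε : ℝ} (hε : 0 < ε) : Continuous fun u : ℝ => 1 / √(u ^ 2 + ε ^ 2) := by
  refine Continuous.div continuous_const (by fun_prop) fun u => ?_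
  have : 0 < ε ^ 2 := by positivity
  positivity

lemma integral_inv_sqrt {ε : ℝ} (hε : 0 < ε) (c : ℝ) :
    ∫ u in (-c)..c, 1 / √(u ^ 2 + ε ^ 2) = 2 * Real.arsinh (c / ε) := by
  rw [intervalIntegral.integral_eq_sub_of_hasDerivAt (fun u _ => hasDerivAt_arsinh_div hε u)
    ((continuous_inv_sqrt hε).intervalIntegrable _ _), neg_div, Real.arsinh_neg]
  ring

lemma integral_half_chord {ε : ℝ} (hε : 0 < ε) (u R : ℝ) :
    ∫ w in (0 : ℝ)..R, -w / √(u ^ 2 + w ^ 2 + ε ^ 2) ^ 3 =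
      1 / √(u ^ 2 + R ^ 2 + ε ^ 2) - 1 / √(u ^ 2 + ε ^ 2) := by
  have hpos : ∀ w : ℝ, 0 < u ^ 2 + w ^ 2 + ε ^ 2 := fun w => by positivity
  have hd : ∀ w : ℝ, HasDerivAt (fun w => 1 / √(u ^ 2 + w ^ 2 + ε ^ 2))
      (-w / √(u ^ 2 + w ^ 2 + ε ^ 2) ^ 3) w := by
    intro w
    have h1 : HasDerivAt (fun w : ℝ => u ^ 2 + w ^ 2 + ε ^ 2) (2 * w) w := by
      simpa using ((hasDerivAt_pow 2 w).const_add (u ^ 2)).add_const (ε ^ 2)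
    have h2 := (h1.sqrt (hpos w).ne').inv (Real.sqrt_pos.2 (hpos w)).ne'
    have h3 := Real.sqrt_pos.2 (hpos w)
    have h4 := h2.congr_deriv (g' := -w / √(u ^ 2 + w ^ 2 + ε ^ 2) ^ 3) (by field_simp)
    simp only [one_div]
    exact h4
  have hc : Continuous fun w : ℝ => -w / √(u ^ 2 + w ^ 2 + ε ^ 2) ^ 3 :=
    Continuous.div (by fun_prop) (by fun_prop) fun w =>
      (pow_pos (Real.sqrt_pos.2 (hpos w)) 3).ne'
  rw [intervalIntegral.integral_eq_sub_of_hasDerivAt (fun w _ => hd w) (hc.intervalIntegrable _ _)]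
  simp

/-- The integral of the regularized kernel over a half disk. -/
lemma integral_softKernel_half_disk {τ : Plane} (hτ : ‖τ‖ = 1) (y : Plane) {ε : ℝ} (hε : 0 < ε) :
    ∫ x in {x | inner ℝ (x - y) (-perp τ) < 0} ∩ Metric.ball y 1, softKernel (-perp τ) y ε x =
      2 / √(1 + ε ^ 2) - 2 * Real.arsinh (1 / ε) := by
  set S : Set Plane := {x | inner ℝ (x - y) (-perp τ) < 0} ∩ Metric.ball y 1 with hS
  have hSm : MeasurableSet S :=
    (isOpen_lt (by fun_prop) continuous_const).measurableSet.inter Metric.isOpen_ball.measurableSet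
  have hI : IntegrableOn (softKernel (-perp τ) y ε) S :=
    integrableOn_softKernel _ _ hε (Metric.isBounded_ball.subset inter_subset_right)
  set F : Plane → ℝ := S.indicator (softKernel (-perp τ) y ε) with hF
  have hFi : Integrable F := hI.integrable_indicator hSm
  have hFi' : Integrable fun z => F (z + y) := hFi.comp_add_right y
  have hFc : ∀ u w : ℝ, F (u • τ + w • perp τ + y) =
      if 0 < w ∧ u ^ 2 + w ^ 2 < 1 then -w / √(u ^ 2 + w ^ 2 + ε ^ 2) ^ 3 else 0 := by
    intro u w
    classical
    have h1 : ‖u • τ + w • perp τ‖ ^ 2 = u ^ 2 + w ^ 2 := by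
      rw [← real_inner_self_eq_norm_sq]
      simp only [inner_add_left, inner_add_right, real_inner_smul_left, real_inner_smul_right,
        inner_perp_self, inner_self_perp, real_inner_self_eq_norm_sq, norm_perp, hτ, norm_smul,
        mul_pow, Real.norm_eq_abs, sq_abs]
      ring
    have h2 : inner ℝ (u • τ + w • perp τ) (-perp τ) = -w := by
      simp only [inner_add_left, inner_neg_right, real_inner_smul_left,
        inner_self_perp, real_inner_self_eq_norm_sq, norm_perp, hτ]
      ring
    have h3 : u • τ + w • perp τ + y ∈ S ↔ 0 < w ∧ u ^ 2 + w ^ 2 < 1 := by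
      simp only [hS, mem_inter_iff, mem_ofPred_eq, add_sub_cancel_right, h2, Metric.mem_ball,
        dist_eq_norm, neg_lt_zero]
      rw [← h1, sq_lt_one_iff₀ (norm_nonneg _)]
    rw [hF, indicator_apply]
    simp only [h3, softKernel, softNorm, add_sub_cancel_right, h1]
    rw [real_inner_comm, h2]
  rw [← integral_indicator hSm, ← integral_add_right_eq_self F y, integral_frame hτ hFi']
  simp only [hFc]
  have hinner : ∀ u : ℝ, (∫ w : ℝ, if 0 < w ∧ u ^ 2 + w ^ 2 < 1 then
      -w / √(u ^ 2 + w ^ 2 + ε ^ 2) ^ 3 else 0) =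
      (Ioo (-1 : ℝ) 1).indicator (fun u => 1 / √(1 + ε ^ 2) - 1 / √(u ^ 2 + ε ^ 2)) u := by
    intro u
    by_cases hu : u ∈ Ioo (-1 : ℝ) 1
    · have hu1 : 0 < 1 - u ^ 2 := by nlinarith [hu.1, hu.2]
      have hR : √(1 - u ^ 2) ^ 2 = 1 - u ^ 2 := Real.sq_sqrt hu1.le
      have hR0 : 0 ≤ √(1 - u ^ 2) := Real.sqrt_nonneg _
      -- The chord over `u` ends on the unit circle, where the antiderivative takes the value `1 /
      -- √(1 + ε²)` independently of `u`.
      have h1 := integral_half_chord hε u √(1 - u ^ 2)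
      rw [hR, show u ^ 2 + (1 - u ^ 2) = 1 by ring] at h1
      rw [indicator_of_mem hu, ← h1, intervalIntegral.integral_of_le hR0,
        integral_Ioc_eq_integral_Ioo, ← integral_indicator measurableSet_Ioo]
      refine integral_congr_ae (Eventually.of_forall fun w => ?_)
      dsimp only
      classical
      rw [indicator_apply]
      refine if_congr (and_congr_right fun hw => ?_) rfl rfl
      rw [Real.lt_sqrt hw.le, lt_sub_iff_add_lt, add_comm]
    · rw [indicator_of_notMem hu]
      refine integral_eq_zero_of_ae (Eventually.of_forall fun w => ?_)
      refine if_neg fun hw => hu ?_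
      rw [mem_Ioo, ← abs_lt, ← sq_lt_one_iff_abs_lt_one]
      nlinarith [hw.2, sq_nonneg w]
  simp only [hinner]
  rw [integral_indicator measurableSet_Ioo, ← integral_Ioc_eq_integral_Ioo,
    ← intervalIntegral.integral_of_le (by norm_num), intervalIntegral.integral_sub
      (by simp) ((continuous_inv_sqrt hε).intervalIntegrable _ _), integral_inv_sqrt hε]
  simp
  ring

/-! ### The near field -/

/-- On `Ω \ H` the function equals its absolute value, on `H \ Ω` minus it, and on `Ω ∩ H` the two
terms cancel. This removes the absolute value from the near field. -/
lemma indicator_symmDiff_abs {Ω H B : Set Plane} {k : Plane → ℝ}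
    (hneg : ∀ x ∈ H, k x ≤ 0) (hpos : ∀ x, x ∉ H → 0 ≤ k x) (x : Plane) :
    (symmDiff Ω H ∩ B).indicator (fun x => |k x|) x =
      (Ω ∩ B).indicator k x - (H ∩ B).indicator k x := by
  by_cases hB : x ∈ B <;> by_cases hΩ : x ∈ Ω <;> by_cases hH : x ∈ H <;>
    simp [indicator, mem_symmDiff, hB, hΩ, hH]
  · exact hpos x hH
  · exact hneg x hH

/-- The regularized absolute values increase to the singular one as `ε` decreases, so monotone
convergence applies without assuming integrability; finiteness of the near field comes from the
limit `L`. -/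
lemma lintegral_near_eq {Ω : Set Plane} (hΩ : NullMeasurableSet Ω volume) {ν y : Plane} {L : ℝ}
    {e : ℕ → ℝ} (he : ∀ k, 0 < e k) (hanti : Antitone e) (he0 : Tendsto e atTop (𝓝 0))
    (hL : Tendsto (fun k => (∫ x in Ω ∩ Metric.ball y 1, softKernel ν y (e k) x) -
      ∫ x in {x | inner ℝ (x - y) ν < 0} ∩ Metric.ball y 1, softKernel ν y (e k) x) atTop (𝓝 L)) :
    0 ≤ L ∧ ∫⁻ x in symmDiff Ω {x | inner ℝ (x - y) ν < 0} ∩ Metric.ball y 1,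
      ENNReal.ofReal |inner ℝ ν (x - y) / ‖x - y‖ ^ 3| = ENNReal.ofReal L := by
  set H : Set Plane := {x | inner ℝ (x - y) ν < 0} with hH
  set B := Metric.ball y 1 with hB
  have hHm : MeasurableSet H := (isOpen_lt (by fun_prop) continuous_const).measurableSet
  have hBm : MeasurableSet B := Metric.isOpen_ball.measurableSet
  have hΩB : NullMeasurableSet (Ω ∩ B) volume := hΩ.inter hBm.nullMeasurableSet
  have hDm : NullMeasurableSet (symmDiff Ω H ∩ B) volume := by
    refine NullMeasurableSet.inter ?_ hBm.nullMeasurableSet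
    rw [Set.symmDiff_def]
    exact (hΩ.diff hHm.nullMeasurableSet).union (hHm.nullMeasurableSet.diff hΩ)
  have hbd : Bornology.IsBounded B := Metric.isBounded_ball
  have hlim := lintegral_tendsto_of_tendsto_of_monotone
    (μ := volume.restrict (symmDiff Ω H ∩ B))
    (f := fun k x => ENNReal.ofReal |softKernel ν y (e k) x|)
    (F := fun x => ENNReal.ofReal |inner ℝ ν (x - y) / ‖x - y‖ ^ 3|)
    (fun k => ((continuous_abs.measurable.comp
      (measurable_softKernel ν y (e k))).ennreal_ofReal).aemeasurable)
    (Eventually.of_forall fun x k l hkl => ENNReal.ofReal_le_ofReal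
      (abs_softKernel_anti ν y (he l).le (hanti hkl) x))
    (Eventually.of_forall fun x => (ENNReal.continuous_ofReal.tendsto _).comp
      (tendsto_softKernel he0 ν y x).abs)
  have hi : ∀ k, ∀ {s : Set Plane}, s ⊆ B → IntegrableOn (softKernel ν y (e k)) s := fun k _ hs =>
    integrableOn_softKernel ν y (he k) (hbd.subset hs)
  have heq : ∀ k, (∫ x in Ω ∩ B, softKernel ν y (e k) x) - ∫ x in H ∩ B, softKernel ν y (e k) x =
      ∫ x in symmDiff Ω H ∩ B, |softKernel ν y (e k) x| := by
    intro k
    rw [← integral_indicator₀ hDm, ← integral_indicator₀ hΩB,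
      ← integral_indicator (hHm.inter hBm), ← integral_sub
        ((hi k inter_subset_right).integrable_indicator₀ hΩB)
        ((hi k inter_subset_right).integrable_indicator (hHm.inter hBm))]
    refine integral_congr_ae (Eventually.of_forall fun x => ?_)
    refine (indicator_symmDiff_abs (fun x hx => ?_) (fun x hx => ?_) x).symm
    · refine div_nonpos_of_nonpos_of_nonneg ?_ (pow_nonneg (softNorm_nonneg _ _) 3)
      rw [real_inner_comm]; exact le_of_lt hx
    · refine div_nonneg ?_ (pow_nonneg (softNorm_nonneg _ _) 3)
      rw [real_inner_comm]; exact not_lt.1 hx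
  simp only [heq] at hL
  refine ⟨ge_of_tendsto' hL fun k => integral_nonneg fun x => abs_nonneg _,
    tendsto_nhds_unique hlim (((ENNReal.continuous_ofReal.tendsto L).comp hL).congr fun k => ?_)⟩
  rw [← ofReal_integral_eq_lintegral_ofReal (hi k inter_subset_right).abs
    (Eventually.of_forall fun x => abs_nonneg _), Function.comp_apply]

/-- Outside the unit disk all regularized kernels are bounded by `1`, which is integrable on a set
of finite area. -/
lemma tendsto_far {Ω : Set Plane} (hΩ : NullMeasurableSet Ω volume) (harea : volume Ω < ⊤)
    {ν y : Plane} (hν : ‖ν‖ = 1) {e : ℕ → ℝ} (he0 : Tendsto e atTop (𝓝 0)) :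
    Tendsto (fun k => ∫ x in Ω \ Metric.ball y 1, softKernel ν y (e k) x) atTop
      (𝓝 (∫ x in Ω \ Metric.ball y 1, inner ℝ ν (x - y) / ‖x - y‖ ^ 3)) := by
  have hm : NullMeasurableSet (Ω \ Metric.ball y 1) volume :=
    hΩ.diff Metric.isOpen_ball.measurableSet.nullMeasurableSet
  refine tendsto_integral_of_dominated_convergence (fun _ => (1 : ℝ))
    (fun k => (measurable_softKernel ν y (e k)).aestronglyMeasurable) ?_ (fun k => ?_)
    (Eventually.of_forall fun x => tendsto_softKernel he0 ν y x)
  · refine integrableOn_const ?_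
    exact ((measure_mono sdiff_subset).trans_lt harea).ne
  · filter_upwards [ae_restrict_mem₀ hm] with x hx
    refine abs_softKernel_le_one hν ?_ _
    have := hx.2
    rw [Metric.mem_ball, not_lt, dist_eq_norm] at this
    exact this

/-! ### Interaction densities -/

namespace IsArcLengthJordanCurve

variable {P : ℝ} {γ : ℝ → Plane}

/-- The regularized self-interaction density is bounded uniformly in the regularization. -/
lemma exists_softSelf_bound (h : IsArcLengthJordanCurve P γ) :
    ∃ C : ℝ, ∀ t s ε, |s| ≤ P / 2 → s ≠ 0 →
      |1 / √(s ^ 2 + ε ^ 2) - inner ℝ (perp (deriv γ (t + s))) (perp (deriv γ t)) /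
        softNorm ε (γ (t + s) - γ t)| ≤ C := by
  obtain ⟨K, hK0, hK⟩ := h.exists_curvature_bound
  obtain ⟨c, hc, hchord⟩ := h.exists_chord_arc
  refine ⟨K ^ 2 * P / c, fun t s ε hs hs0 => ?_⟩
  rw [inner_perp_perp]
  have hx : 0 < |s| := abs_pos.2 hs0
  have ha0 : 0 ≤ 1 - inner ℝ (deriv γ (t + s)) (deriv γ t) := by
    rw [h.one_sub_inner]; positivity
  have ha1 := h.one_sub_inner_le hK (t + s) t
  have hd1 := h.sub_cube_le_norm_sub hK (t + s) t
  have hd2 := h.norm_sub_le (t + s) t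
  have hd3 := hchord t s hs
  have hDd := norm_le_softNorm ε (γ (t + s) - γ t)
  rw [add_sub_cancel_left] at ha1 hd1 hd2
  have hD2 : softNorm ε (γ (t + s) - γ t) ^ 2 = ‖γ (t + s) - γ t‖ ^ 2 + ε ^ 2 :=
    Real.sq_sqrt (by positivity)
  have hS2 : √(s ^ 2 + ε ^ 2) ^ 2 = |s| ^ 2 + ε ^ 2 := by
    rw [Real.sq_sqrt (by positivity), sq_abs]
  have hSs : |s| ≤ √(s ^ 2 + ε ^ 2) := by
    refine Real.le_sqrt_of_sq_le ?_
    rw [sq_abs]; nlinarith [sq_nonneg ε]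
  generalize inner ℝ (deriv γ (t + s)) (deriv γ t) = a at *
  generalize softNorm ε (γ (t + s) - γ t) = D at *
  generalize √(s ^ 2 + ε ^ 2) = S at *
  generalize ‖γ (t + s) - γ t‖ = d at *
  generalize |s| = x at *
  have hd0 : 0 < d := (mul_pos hc hx).trans_le hd3
  have hD0 : 0 < D := hd0.trans_le hDd
  have hS0 : 0 < S := hx.trans_le hSs
  -- The cubic deficit of the chord becomes quartic for squares. Since `S² - D² = x² - d²`, the
  -- regularization drops out, which makes the bound uniform in `ε`.
  have hsd : x ^ 2 - d ^ 2 ≤ K ^ 2 * x ^ 4 := by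
    have h1 : x - d ≤ K ^ 2 * x ^ 3 / 2 := by linarith
    have h2 : x ^ 2 - d ^ 2 = (x - d) * (x + d) := by ring
    rw [h2]
    calc (x - d) * (x + d) ≤ K ^ 2 * x ^ 3 / 2 * (x + d) := by gcongr
      _ ≤ K ^ 2 * x ^ 3 / 2 * (x + x) := by gcongr
      _ = K ^ 2 * x ^ 4 := by ring
  have hDS : D ≤ S := by
    refine le_of_sq_le_sq ?_ hS0.le
    nlinarith
  -- The deviation of the tangents and that of the chord from the arc are separated; each term is
  -- nonnegative and of order `x`.
  have e1 : 1 / S - a / D = (1 - a) / D - (1 / D - 1 / S) := by ring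
  have hcxD : c * x ≤ D := hd3.trans hDd
  have b1 : (1 - a) / D ≤ K ^ 2 * x / (2 * c) := by
    rw [div_le_div_iff₀ hD0 (by positivity)]
    calc (1 - a) * (2 * c) ≤ K ^ 2 * x ^ 2 / 2 * (2 * c) := by gcongr
      _ = K ^ 2 * x * (c * x) := by ring
      _ ≤ K ^ 2 * x * D := by gcongr
  have b2 : 1 / D - 1 / S ≤ K ^ 2 * x / c := by
    have e2 : 1 / D - 1 / S = (S ^ 2 - D ^ 2) / (D * S * (S + D)) := by
      field_simp; ring
    rw [e2, div_le_div_iff₀ (by positivity) hc]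
    have e3 : S ^ 2 - D ^ 2 ≤ K ^ 2 * x ^ 4 := by linarith
    calc (S ^ 2 - D ^ 2) * c ≤ K ^ 2 * x ^ 4 * c := by gcongr
      _ = K ^ 2 * x * ((c * x) * x * (x + 0)) := by ring
      _ ≤ K ^ 2 * x * (D * S * (S + D)) := by gcongr
  have b3 : 0 ≤ (1 - a) / D := by positivity
  have b4 : 0 ≤ 1 / D - 1 / S := sub_nonneg.2 (one_div_le_one_div_of_le hD0 hDS)
  have b5 : K ^ 2 * x / (2 * c) ≤ K ^ 2 * P / c := by
    rw [div_le_div_iff₀ (by positivity) hc]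
    nlinarith [mul_nonneg (sq_nonneg K) hc.le, h.length_pos,
      mul_nonneg (mul_nonneg (sq_nonneg K) hc.le) (by linarith [h.length_pos] : 0 ≤ 2 * P - x)]
  have b6 : K ^ 2 * x / c ≤ K ^ 2 * P / c := by
    gcongr; linarith [h.length_pos]
  rw [e1, abs_le]
  constructor <;> linarith

lemma continuous_softSelf (h : IsArcLengthJordanCurve P γ) (t : ℝ) {ε : ℝ} (hε : 0 < ε) :
    Continuous fun s => inner ℝ (perp (deriv γ (t + s))) (perp (deriv γ t)) /
        softNorm ε (γ (t + s) - γ t) := by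
  have h1 := h.continuous
  have h2 := h.continuous_deriv
  exact Continuous.div (by fun_prop) (by fun_prop) fun s => (softNorm_pos hε _).ne'

lemma measurable_selfDensity (h : IsArcLengthJordanCurve P γ) :
    Measurable fun p : ℝ × ℝ => selfDensity γ p.1 p.2 := by
  have h1 := h.continuous
  have h2 := h.continuous_deriv
  unfold selfDensity
  refine Measurable.sub ?_ ?_
  · exact measurable_const.div (by fun_prop : Continuous fun p : ℝ × ℝ => |p.2|).measurable
  · exact (by fun_prop : Continuous fun p : ℝ × ℝ =>
      inner ℝ (perp (deriv γ (p.1 + p.2))) (perp (deriv γ p.1))).measurable.div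
      (by fun_prop : Continuous fun p : ℝ × ℝ => ‖γ (p.1 + p.2) - γ p.1‖).measurable

lemma integrableOn_selfDensity (h : IsArcLengthJordanCurve P γ) :
    IntegrableOn (fun p : ℝ × ℝ => selfDensity γ p.1 p.2)
      (Icc 0 P ×ˢ Icc (-(P / 2)) (P / 2)) := by
  obtain ⟨C, hC⟩ := h.exists_softSelf_bound
  refine IntegrableOn.of_bound (C := C) ?_ h.measurable_selfDensity.aestronglyMeasurable ?_
  · exact (isCompact_Icc.prod isCompact_Icc).measure_lt_top
  · filter_upwards [ae_restrict_mem (measurableSet_Icc.prod measurableSet_Icc)] with p hp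
    -- At `s = 0` both quotients have denominator zero, so the density has the value `0`.
    rcases eq_or_ne p.2 0 with h0 | h0
    · have hC0 : 0 ≤ C := (abs_nonneg _).trans
        (hC 0 (P / 2) 0 (abs_of_pos (half_pos h.length_pos)).le (half_pos h.length_pos).ne')
      simpa [selfDensity, h0] using hC0
    · have := hC p.1 p.2 0 (abs_le.2 hp.2) h0
      simpa [selfDensity, softNorm_zero, Real.sqrt_sq_eq_abs] using this

lemma tendsto_softSelf (h : IsArcLengthJordanCurve P γ) (t : ℝ) {e : ℕ → ℝ} (he : ∀ k, 0 < e k)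
    (he0 : Tendsto e atTop (𝓝 0)) :
    Tendsto (fun k => ∫ s in (-(P / 2))..(P / 2), (1 / √(s ^ 2 + e k ^ 2) -
      inner ℝ (perp (deriv γ (t + s))) (perp (deriv γ t)) / softNorm (e k) (γ (t + s) - γ t)))
      atTop (𝓝 (∫ s in (-(P / 2))..(P / 2), selfDensity γ t s)) := by
  obtain ⟨C, hC⟩ := h.exists_softSelf_bound
  have hP := h.length_pos
  have hne : ∀ᵐ s : ℝ, s ≠ 0 := by simp [ae_iff]
  refine intervalIntegral.tendsto_integral_filter_of_dominated_convergence (fun _ => C) ?_ ?_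
    (by simp) ?_
  · exact Eventually.of_forall fun k =>
      ((continuous_inv_sqrt (he k)).sub (h.continuous_softSelf t (he k))).aestronglyMeasurable
  · refine Eventually.of_forall fun k => ?_
    filter_upwards [hne] with s hs hsm
    rw [uIoc_of_le (by linarith)] at hsm
    exact hC t s (e k) (abs_le.2 ⟨hsm.1.le, hsm.2⟩) hs
  · filter_upwards [hne] with s hs hsm
    rw [uIoc_of_le (by linarith)] at hsm
    have hpos : ‖γ (t + s) - γ t‖ ≠ 0 := by
      rw [norm_ne_zero_iff, sub_ne_zero]
      intro hγ
      have h1 : |s| ≤ P / 2 := abs_le.2 ⟨hsm.1.le, hsm.2⟩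
      have := h.eq_of_apply_eq (by rw [add_sub_cancel_left]; linarith) hγ
      exact hs (by linarith)
    refine Tendsto.sub ?_ (tendsto_const_nhds.div (tendsto_softNorm he0 _) hpos)
    have hc : Continuous fun ε : ℝ => √(s ^ 2 + ε ^ 2) := by fun_prop
    have h1 : Tendsto (fun k => √(s ^ 2 + e k ^ 2)) atTop (𝓝 |s|) := by
      simpa [Real.sqrt_sq_eq_abs, Function.comp_def] using (hc.tendsto 0).comp he0
    exact tendsto_const_nhds.div h1 (abs_ne_zero.2 hs)

/-- Centring the period at `t` and subtracting `1 / √(s² + ε²)` isolates the logarithmic divergence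
in the explicit `arsinh` term. -/
lemma integral_softSelf (h : IsArcLengthJordanCurve P γ) (t : ℝ) {ε : ℝ} (hε : 0 < ε) :
    ∫ s in (0 : ℝ)..P, inner ℝ (perp (deriv γ s)) (perp (deriv γ t)) / softNorm ε (γ s - γ t) =
      2 * Real.arsinh (P / 2 / ε) - ∫ s in (-(P / 2))..(P / 2), (1 / √(s ^ 2 + ε ^ 2) -
        inner ℝ (perp (deriv γ (t + s))) (perp (deriv γ t)) / softNorm ε (γ (t + s) - γ t)) := by
  rw [intervalIntegral.integral_sub ((continuous_inv_sqrt hε).intervalIntegrable _ _)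
    ((h.continuous_softSelf t hε).intervalIntegrable _ _), integral_inv_sqrt hε, sub_sub_cancel]
  set q : ℝ → ℝ := fun s =>
    inner ℝ (perp (deriv γ s)) (perp (deriv γ t)) / softNorm ε (γ s - γ t) with hq
  have hper : Function.Periodic q P := fun s => by
    simp only [hq, h.periodic s, h.periodic_deriv s]
  have h1 := hper.intervalIntegral_add_eq 0 (t + -(P / 2))
  rw [zero_add, show t + -(P / 2) + P = t + P / 2 by ring] at h1
  rw [h1]
  exact (intervalIntegral.integral_comp_add_left q t).symm

end IsArcLengthJordanCurve

/-- `arsinh (b / ε) = log (b + √(ε² + b²)) - log ε`, and the terms `log ε` cancel in the difference.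
-/
lemma tendsto_arsinh_div_sub {c : ℝ} (hc : 0 < c) {e : ℕ → ℝ} (he : ∀ k, 0 < e k)
    (he0 : Tendsto e atTop (𝓝 0)) :
    Tendsto (fun k => Real.arsinh (c / e k) - Real.arsinh (1 / e k)) atTop (𝓝 (Real.log c)) := by
  have hform : ∀ {b : ℝ}, 0 < b → ∀ k, Real.arsinh (b / e k) =
      Real.log (b + √(e k ^ 2 + b ^ 2)) - Real.log (e k) := by
    intro b hb k
    have hk := he k
    have h1 : √(1 + (b / e k) ^ 2) = √(e k ^ 2 + b ^ 2) / e k := by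
      rw [show 1 + (b / e k) ^ 2 = (e k ^ 2 + b ^ 2) / e k ^ 2 by field_simp,
        Real.sqrt_div (by positivity), Real.sqrt_sq hk.le]
    rw [Real.arsinh, h1, ← add_div, Real.log_div (by positivity) hk.ne']
  have hlim : ∀ {b : ℝ}, 0 < b → Tendsto (fun k => Real.log (b + √(e k ^ 2 + b ^ 2))) atTop
      (𝓝 (Real.log (b + b))) := by
    intro b hb
    have hcont : ContinuousAt (fun x : ℝ => Real.log (b + √(x ^ 2 + b ^ 2))) 0 := by
      refine ContinuousAt.log (by fun_prop) (by positivity)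
    have := hcont.tendsto.comp he0
    simpa [Function.comp_def, Real.sqrt_sq hb.le] using this
  have h2 := (hlim hc).sub (hlim one_pos)
  have h3 : Real.log (c + c) - Real.log (1 + 1) = Real.log c := by
    rw [← two_mul, Real.log_mul two_ne_zero hc.ne']; norm_num
  rw [h3] at h2
  refine h2.congr fun k => ?_
  rw [hform hc, hform one_pos]; ring

lemma mutualDensity_comm (γ η : ℝ → Plane) (t s : ℝ) :
    mutualDensity γ η t s = mutualDensity η γ s t := by
  rw [mutualDensity, mutualDensity, real_inner_comm, norm_sub_rev]

namespace IsBoundedBy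

variable {Ω : Set Plane} {N : ℕ} {P : Fin N → ℝ} {γ : Fin N → ℝ → Plane}

lemma continuous_mutualDensity (h : IsBoundedBy Ω P γ) {i j : Fin N} (hij : i ≠ j) :
    Continuous fun p : ℝ × ℝ => mutualDensity (γ i) (γ j) p.1 p.2 := by
  have h1 := (h.curve i).continuous
  have h2 := (h.curve i).continuous_deriv
  have h3 := (h.curve j).continuous
  have h4 := (h.curve j).continuous_deriv
  unfold mutualDensity
  refine Continuous.div (by fun_prop) (by fun_prop) fun p => ?_
  rw [norm_ne_zero_iff, sub_ne_zero]
  exact h.ne_of_ne hij.symm _ _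

lemma tendsto_softMutual (h : IsBoundedBy Ω P γ) {i j : Fin N} (hij : i ≠ j) (t : ℝ) {e : ℕ → ℝ}
    (he : ∀ k, 0 < e k) (he0 : Tendsto e atTop (𝓝 0)) :
    Tendsto (fun k => ∫ s in (0 : ℝ)..P j, inner ℝ (perp (deriv (γ j) s)) (perp (deriv (γ i) t)) /
      softNorm (e k) (γ j s - γ i t)) atTop
      (𝓝 (∫ s in (0 : ℝ)..P j, mutualDensity (γ i) (γ j) t s)) := by
  have h3 := (h.curve j).continuous
  have h4 := (h.curve j).continuous_deriv
  have hpos : ∀ s, 0 < ‖γ j s - γ i t‖ := fun s => by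
    rw [norm_pos_iff, sub_ne_zero]; exact h.ne_of_ne hij.symm _ _
  have hcont : Continuous fun s => mutualDensity (γ i) (γ j) t s := by
    have hts : Continuous fun s : ℝ => (t, s) := by fun_prop
    have hc := (h.continuous_mutualDensity hij).comp hts
    exact hc
  refine intervalIntegral.tendsto_integral_filter_of_dominated_convergence
    (fun s => |mutualDensity (γ i) (γ j) t s|) ?_ ?_ (hcont.abs.intervalIntegrable _ _) ?_
  · refine Eventually.of_forall fun k => Continuous.aestronglyMeasurable ?_
    exact Continuous.div (by fun_prop) (by fun_prop) fun s => (softNorm_pos (he k) _).ne'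
  · refine Eventually.of_forall fun k => Eventually.of_forall fun s _ => ?_
    rw [Real.norm_eq_abs, mutualDensity, abs_div, abs_div, abs_norm,
      abs_of_pos (softNorm_pos (he k) _)]
    exact div_le_div_of_nonneg_left (abs_nonneg _) (hpos s) (norm_le_softNorm _ _)
  · refine Eventually.of_forall fun s _ => ?_
    rw [mutualDensity]
    have hne := (hpos s).ne'
    exact Tendsto.div tendsto_const_nhds (tendsto_softNorm he0 _) hne

/-- The far field at the boundary point `γ i t`. -/
def farDensity (Ω : Set Plane) (γ : Fin N → ℝ → Plane) (i : Fin N) (t : ℝ) : ℝ :=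
  ∫ x in Ω \ Metric.ball (γ i t) 1,
    inner ℝ (-perp (deriv (γ i) t)) (x - γ i t) / ‖x - γ i t‖ ^ 3

/-- The sum of the near field and the far field at the boundary point `γ i t`. -/
def fieldDensity (P : Fin N → ℝ) (γ : Fin N → ℝ → Plane) (i : Fin N) (t : ℝ) : ℝ :=
  (∫ s in (-(P i / 2))..(P i / 2), selfDensity (γ i) t s) -
    (∑ j ∈ {i}ᶜ, ∫ s in (0 : ℝ)..P j, mutualDensity (γ i) (γ j) t s) -
    (2 * Real.log (P i / 2) + 2)

/-- The divergence of the self-interaction and that of the half disk cancel, leaving `2 log (P i /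
2)`; the circular edge of the half disk leaves the constant `2`. -/
theorem lintegral_near (h : IsBoundedBy Ω P γ) (i : Fin N) (t : ℝ) :
    0 ≤ fieldDensity P γ i t - farDensity Ω γ i t ∧
    ∫⁻ x in symmDiff Ω {x | inner ℝ (x - γ i t) (-perp (deriv (γ i) t)) < 0} ∩
        Metric.ball (γ i t) 1,
      ENNReal.ofReal |inner ℝ (-perp (deriv (γ i) t)) (x - γ i t) / ‖x - γ i t‖ ^ 3| =
      ENNReal.ofReal (fieldDensity P γ i t - farDensity Ω γ i t) := by
  have hγ := h.curve i
  have hP := hγ.length_pos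
  set e : ℕ → ℝ := fun k => 1 / ((k : ℝ) + 1) with hedef
  have he : ∀ k, 0 < e k := fun k => Nat.one_div_pos_of_nat
  have hanti : Antitone e := fun k l hkl => Nat.one_div_le_one_div hkl
  have he0 : Tendsto e atTop (𝓝 0) := tendsto_one_div_add_atTop_nhds_zero_nat
  set ν := -perp (deriv (γ i) t) with hν
  have hν1 : ‖ν‖ = 1 := by rw [hν, norm_neg, norm_perp, hγ.arcLength]
  refine lintegral_near_eq h.nullMeasurable he hanti he0 ?_
  have hΩ : ∀ k, ∫ x in Ω ∩ Metric.ball (γ i t) 1, softKernel ν (γ i t) (e k) x =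
      (∫ x in Ω, softKernel ν (γ i t) (e k) x) -
        ∫ x in Ω \ Metric.ball (γ i t) 1, softKernel ν (γ i t) (e k) x := by
    intro k
    rw [← integral_inter_add_sdiff (s := Ω) (t := Metric.ball (γ i t) 1)
      Metric.isOpen_ball.measurableSet (integrableOn_softKernel ν _ (he k) h.isBounded)]
    ring
  have hval : ∀ k, (∫ x in Ω ∩ Metric.ball (γ i t) 1, softKernel ν (γ i t) (e k) x) -
      ∫ x in {x | inner ℝ (x - γ i t) ν < 0} ∩ Metric.ball (γ i t) 1,
        softKernel ν (γ i t) (e k) x =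
      (∫ s in (-(P i / 2))..(P i / 2), (1 / √(s ^ 2 + e k ^ 2) -
        inner ℝ (perp (deriv (γ i) (t + s))) (perp (deriv (γ i) t)) /
          softNorm (e k) (γ i (t + s) - γ i t))) -
      (∑ j ∈ {i}ᶜ, ∫ s in (0 : ℝ)..P j, inner ℝ (perp (deriv (γ j) s)) (perp (deriv (γ i) t)) /
        softNorm (e k) (γ j s - γ i t)) -
      (2 * (Real.arsinh (P i / 2 / e k) - Real.arsinh (1 / e k)) + 2 / √(1 + e k ^ 2)) -
      ∫ x in Ω \ Metric.ball (γ i t) 1, softKernel ν (γ i t) (e k) x := by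
    intro k
    rw [hΩ k, hν, integral_softKernel_half_disk (hγ.arcLength t) _ (he k),
      h.integral_softKernel _ _ (he k)]
    simp only [inner_neg_right, neg_div, intervalIntegral.integral_neg, Finset.sum_neg_distrib]
    rw [Fintype.sum_eq_add_sum_compl i, hγ.integral_softSelf t (he k)]
    ring
  simp only [hval]
  refine Tendsto.sub (Tendsto.sub (Tendsto.sub (hγ.tendsto_softSelf t he he0) ?_) ?_)
    (tendsto_far h.nullMeasurable h.area hν1 he0)
  · refine tendsto_finsetSum _ fun j hj => h.tendsto_softMutual ?_ t he he0
    simpa [eq_comm] using hj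
  · refine Tendsto.add ((tendsto_arsinh_div_sub (half_pos hP) he he0).const_mul 2) ?_
    have hc : ContinuousAt (fun x : ℝ => 2 / √(1 + x ^ 2)) 0 :=
      ContinuousAt.div (by fun_prop) (by fun_prop) (by positivity)
    simpa [Function.comp_def] using hc.tendsto.comp he0

end IsBoundedBy

/-! ### Integration over the boundary -/

lemma integrableOn_intervalIntegral {f : ℝ → ℝ → ℝ} {a b c d : ℝ} (hcd : c ≤ d)
    (hf : IntegrableOn (fun p : ℝ × ℝ => f p.1 p.2) (Icc a b ×ˢ Icc c d)) :
    IntegrableOn (fun t => ∫ s in c..d, f t s) (Icc a b) := by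
  rw [IntegrableOn, Measure.volume_eq_prod, ← Measure.prod_restrict] at hf
  have h1 := hf.integral_prod_left
  simp only [intervalIntegral.integral_of_le hcd, ← integral_Icc_eq_integral_Ioc]
  exact h1

namespace IsBoundedBy

variable {Ω : Set Plane} {N : ℕ} {P : Fin N → ℝ} {γ : Fin N → ℝ → Plane}

lemma measurable_farDensity (h : IsBoundedBy Ω P γ) (i : Fin N) :
    Measurable (farDensity Ω γ i) := by
  have h1 := (h.curve i).continuous
  have h2 := (h.curve i).continuous_deriv
  set S : Set (ℝ × Plane) := {p | p.2 ∉ Metric.ball (γ i p.1) 1} with hS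
  have hSm : MeasurableSet S := by
    have : S = {p | 1 ≤ dist p.2 (γ i p.1)} := by ext p; simp [hS]
    rw [this]
    exact (isClosed_le continuous_const (by fun_prop)).measurableSet
  set g : ℝ × Plane → ℝ := fun p =>
    inner ℝ (-perp (deriv (γ i) p.1)) (p.2 - γ i p.1) / ‖p.2 - γ i p.1‖ ^ 3 with hg
  have hgm : Measurable g :=
    (by fun_prop : Continuous fun p : ℝ × Plane =>
      inner ℝ (-perp (deriv (γ i) p.1)) (p.2 - γ i p.1)).measurable.div
      (by fun_prop : Continuous fun p : ℝ × Plane => ‖p.2 - γ i p.1‖ ^ 3).measurable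
  have hm := (hgm.indicator hSm).stronglyMeasurable.integral_prod_right' (ν := volume.restrict Ω)
  convert hm.measurable using 1
  funext t
  have hB : MeasurableSet (Metric.ball (γ i t) 1)ᶜ := Metric.isOpen_ball.measurableSet.compl
  -- The moving disk becomes an indicator jointly measurable in `(t, x)`, while `Ω`, which is only
  -- null measurable, enters through the restricted measure alone.
  rw [farDensity, show Ω \ Metric.ball (γ i t) 1 = (Metric.ball (γ i t) 1)ᶜ ∩ Ω by
    rw [inter_comm]; rfl, ← Measure.restrict_restrict hB, ← integral_indicator hB]
  rfl

lemma abs_farDensity_le (h : IsBoundedBy Ω P γ) (i : Fin N) (t : ℝ) :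
    |farDensity Ω γ i t| ≤ volume.real Ω := by
  have hm : NullMeasurableSet (Ω \ Metric.ball (γ i t) 1) volume :=
    h.nullMeasurable.diff Metric.isOpen_ball.measurableSet.nullMeasurableSet
  have hle : volume.real (Ω \ Metric.ball (γ i t) 1) ≤ volume.real Ω :=
    measureReal_mono sdiff_subset h.area.ne
  refine le_trans ?_ hle
  have hfin : volume (Ω \ Metric.ball (γ i t) 1) < ⊤ :=
    (measure_mono sdiff_subset).trans_lt h.area
  have := norm_setIntegral_le_of_norm_le_const_ae (C := 1) hfin (f := fun x =>
    inner ℝ (-perp (deriv (γ i) t)) (x - γ i t) / ‖x - γ i t‖ ^ 3) (by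
      filter_upwards [ae_restrict_mem₀ hm] with x hx
      have hx1 := hx.2
      rw [Metric.mem_ball, not_lt, dist_eq_norm] at hx1
      have := abs_softKernel_le_one (ν := -perp (deriv (γ i) t))
        (by rw [norm_neg, norm_perp, (h.curve i).arcLength]) hx1 0
      rwa [softKernel, softNorm_zero] at this)
  rwa [one_mul] at this

lemma integrableOn_farDensity (h : IsBoundedBy Ω P γ) (i : Fin N) :
    IntegrableOn (farDensity Ω γ i) (Icc 0 (P i)) :=
  IntegrableOn.of_bound isCompact_Icc.measure_lt_top
    (h.measurable_farDensity i).aestronglyMeasurable _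
    (Eventually.of_forall fun t => h.abs_farDensity_le i t)

lemma integrableOn_mutualDensity (h : IsBoundedBy Ω P γ) {i j : Fin N} (hij : i ≠ j) :
    IntegrableOn (fun p : ℝ × ℝ => mutualDensity (γ i) (γ j) p.1 p.2)
      (Icc 0 (P i) ×ˢ Icc 0 (P j)) :=
  (h.continuous_mutualDensity hij).continuousOn.integrableOn_compact
    (isCompact_Icc.prod isCompact_Icc)

lemma integrableOn_integral_self (h : IsBoundedBy Ω P γ) (i : Fin N) :
    IntegrableOn (fun t => ∫ s in (-(P i / 2))..(P i / 2), selfDensity (γ i) t s) (Icc 0 (P i)) :=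
  integrableOn_intervalIntegral (by linarith [(h.curve i).length_pos])
    (h.curve i).integrableOn_selfDensity

lemma integrableOn_integral_mutual (h : IsBoundedBy Ω P γ) {i j : Fin N} (hij : i ≠ j) :
    IntegrableOn (fun t => ∫ s in (0 : ℝ)..P j, mutualDensity (γ i) (γ j) t s) (Icc 0 (P i)) :=
  integrableOn_intervalIntegral (h.curve j).length_pos.le (h.integrableOn_mutualDensity hij)

lemma integrableOn_sum_mutual (h : IsBoundedBy Ω P γ) (i : Fin N) :
    IntegrableOn (fun t => ∑ j ∈ {i}ᶜ, ∫ s in (0 : ℝ)..P j, mutualDensity (γ i) (γ j) t s)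
      (Icc 0 (P i)) :=
  integrable_finsetSum _ fun j hj =>
    h.integrableOn_integral_mutual (by simpa [eq_comm] using hj)

lemma integrableOn_fieldDensity (h : IsBoundedBy Ω P γ) (i : Fin N) :
    IntegrableOn (fieldDensity P γ i) (Icc 0 (P i)) :=
  ((h.integrableOn_integral_self i).sub (h.integrableOn_sum_mutual i)).sub
    (integrableOn_const isCompact_Icc.measure_lt_top.ne)

lemma intervalIntegrable_of_integrableOn {f : ℝ → ℝ} {b : ℝ} (hb : 0 ≤ b)
    (hf : IntegrableOn f (Icc 0 b)) : IntervalIntegrable f volume 0 b :=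
  (intervalIntegrable_iff_integrableOn_Icc_of_le hb).2 hf

lemma integral_fieldDensity (h : IsBoundedBy Ω P γ) (i : Fin N) :
    ∫ t in (0 : ℝ)..P i, fieldDensity P γ i t =
      (∫ t in (0 : ℝ)..P i, ∫ s in (-(P i / 2))..(P i / 2), selfDensity (γ i) t s) -
      (∑ j ∈ {i}ᶜ, ∫ t in (0 : ℝ)..P i, ∫ s in (0 : ℝ)..P j, mutualDensity (γ i) (γ j) t s) -
      P i * (2 * Real.log (P i / 2) + 2) := by
  have hP := (h.curve i).length_pos.le
  have h1 := intervalIntegrable_of_integrableOn hP (h.integrableOn_integral_self i)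
  have h2 := intervalIntegrable_of_integrableOn hP (h.integrableOn_sum_mutual i)
  unfold fieldDensity
  rw [intervalIntegral.integral_sub (h1.sub h2) (by simp), intervalIntegral.integral_sub h1 h2,
    intervalIntegral.integral_finsetSum fun j hj => intervalIntegrable_of_integrableOn hP
      (h.integrableOn_integral_mutual (by simpa [eq_comm] using hj))]
  simp only [intervalIntegral.integral_const, sub_zero, smul_eq_mul]

theorem farField_eq (h : IsBoundedBy Ω P γ) :
    farField Ω = ∑ i, ∫ t in (0 : ℝ)..P i, farDensity Ω γ i t := by
  rw [farField, h.reducedBoundary_eq, h.integral_frontier]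
  · simp only [h.outerNormal_curve]
    rfl
  · intro i
    simp only [h.outerNormal_curve]
    exact (h.integrableOn_farDensity i).mono_set Ico_subset_Icc_self

theorem nearField_eq (h : IsBoundedBy Ω P γ) :
    nearField Ω = ENNReal.ofReal
      (∑ i, ∫ t in (0 : ℝ)..P i, (fieldDensity P γ i t - farDensity Ω γ i t)) := by
  have hP := fun i => (h.curve i).length_pos.le
  rw [nearField, h.reducedBoundary_eq, h.lintegral_frontier, ENNReal.ofReal_sum_of_nonneg
    fun i _ => intervalIntegral.integral_nonneg (hP i) fun t _ => (h.lintegral_near i t).1]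
  refine Finset.sum_congr rfl fun i _ => ?_
  simp only [halfPlane, h.outerNormal_curve, (h.lintegral_near i _).2]
  rw [intervalIntegral.integral_of_le (hP i), ← integral_Ico_eq_integral_Ioc,
    ofReal_integral_eq_lintegral_ofReal (f := fun t => fieldDensity P γ i t - farDensity Ω γ i t)
      (((h.integrableOn_fieldDensity i).sub (h.integrableOn_farDensity i)).mono_set
        Ico_subset_Icc_self) (Eventually.of_forall fun t => (h.lintegral_near i t).1)]

lemma sum_nonneg_near (h : IsBoundedBy Ω P γ) :
    0 ≤ ∑ i, ∫ t in (0 : ℝ)..P i, (fieldDensity P γ i t - farDensity Ω γ i t) :=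
  Finset.sum_nonneg fun i _ => intervalIntegral.integral_nonneg (h.curve i).length_pos.le
    fun t _ => (h.lintegral_near i t).1

lemma integral_mutual_comm (h : IsBoundedBy Ω P γ) {i j : Fin N} (hij : i ≠ j) :
    ∫ t in (0 : ℝ)..P i, ∫ s in (0 : ℝ)..P j, mutualDensity (γ i) (γ j) t s =
      ∫ t in (0 : ℝ)..P j, ∫ s in (0 : ℝ)..P i, mutualDensity (γ j) (γ i) t s := by
  rw [intervalIntegral_intervalIntegral_swap]
  · simp only [mutualDensity_comm (γ i) (γ j)]
  · refine IntegrableOn.mono_set (h.integrableOn_mutualDensity hij) ?_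
    rw [uIoc_of_le (h.curve i).length_pos.le, uIoc_of_le (h.curve j).length_pos.le]
    exact prod_mono Ioc_subset_Icc_self Ioc_subset_Icc_self

/-- The mutual interaction is symmetric by Fubini, so every unordered pair occurs twice. -/
lemma sum_mutual (h : IsBoundedBy Ω P γ) :
    ∑ i, ∑ j ∈ {i}ᶜ, ∫ t in (0 : ℝ)..P i, ∫ s in (0 : ℝ)..P j, mutualDensity (γ i) (γ j) t s =
      2 * ∑ i, ∑ j ∈ Finset.Ioi i,
        ∫ t in (0 : ℝ)..P i, ∫ s in (0 : ℝ)..P j, mutualDensity (γ i) (γ j) t s := by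
  rw [← Finset.sum_sum_Ioi_add_eq_sum_sum_off_diag fun j i =>
    ∫ t in (0 : ℝ)..P i, ∫ s in (0 : ℝ)..P j, mutualDensity (γ i) (γ j) t s, Finset.mul_sum]
  refine Finset.sum_congr rfl fun i _ => ?_
  rw [Finset.mul_sum]
  refine Finset.sum_congr rfl fun j hj => ?_
  rw [h.integral_mutual_comm (i := j) (j := i) (Finset.mem_Ioi.1 hj).ne']
  ring

theorem E10_eq (h : IsBoundedBy Ω P γ) :
    E10 Ω = ((-(∑ i, P i * (Real.log (P i / 2) + 2))
        + (1 / 2) * (∑ i, ∫ t in (0 : ℝ)..(P i), (∫ s in (-(P i / 2))..(P i / 2),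
            selfDensity (γ i) t s))
        - (∑ i, ∑ j ∈ Finset.Ioi i, ∫ t in (0 : ℝ)..(P i), (∫ s in (0 : ℝ)..(P j),
            mutualDensity (γ i) (γ j) t s)) : ℝ) : EReal) := by
  have hP := fun i => (h.curve i).length_pos.le
  have hX := h.sum_nonneg_near
  set X := ∑ i, ∫ t in (0 : ℝ)..P i, (fieldDensity P γ i t - farDensity Ω γ i t) with hXdef
  -- The far field cancels here: the near field contains it with the opposite sign.
  have hXe : X + farField Ω = ∑ i, ∫ t in (0 : ℝ)..P i, fieldDensity P γ i t := by
    rw [h.farField_eq, hXdef, ← Finset.sum_add_distrib]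
    refine Finset.sum_congr rfl fun i _ => ?_
    rw [intervalIntegral.integral_sub
      (intervalIntegrable_of_integrableOn (hP i) (h.integrableOn_fieldDensity i))
      (intervalIntegrable_of_integrableOn (hP i) (h.integrableOn_farDensity i)), sub_add_cancel]
  have hnear : nearField Ω / 2 = ENNReal.ofReal (X / 2) := by
    rw [h.nearField_eq, ENNReal.ofReal_div_of_pos two_pos, ENNReal.ofReal_ofNat]
  have hEreal : E10 Ω = ((-(∑ i, P i) + X / 2 + farField Ω / 2 : ℝ) : EReal) := by
    rw [E10, h.perimeter_eq, hnear, EReal.coe_ennreal_ofReal, EReal.coe_ennreal_ofReal,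
      max_eq_left (Finset.sum_nonneg fun i _ => hP i), max_eq_left (by positivity)]
    norm_cast
  rw [hEreal]
  congr 1
  rw [add_assoc, ← add_div, hXe]
  simp only [h.integral_fieldDensity]
  rw [Finset.sum_sub_distrib, Finset.sum_sub_distrib, h.sum_mutual]
  -- Half of `2 log (P i / 2) + 2` gives only `log (P i / 2) + 1`; the missing `1` per unit length
  -- is the perimeter term.
  have hlog : ∑ i, P i * (2 * Real.log (P i / 2) + 2) =
      2 * ∑ i, P i * (Real.log (P i / 2) + 2) - 2 * ∑ i, P i := by
    rw [Finset.mul_sum, Finset.mul_sum, ← Finset.sum_sub_distrib]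
    exact Finset.sum_congr rfl fun i _ => by ring
  rw [hlog]
  ring

end IsBoundedBy

end DipolarEnergy

end

theorem mainTheorem6 (Ω : Set DipolarEnergy.Plane)
    (hΩ_meas : NullMeasurableSet Ω volume) (hΩ_area : volume Ω < ⊤)
    (hΩ_per : DipolarEnergy.perimeter Ω < ⊤) (hΩ_C2 : DipolarEnergy.HasC2Boundary Ω)
    (N : ℕ) (P : Fin N → ℝ) (γ : Fin N → ℝ → DipolarEnergy.Plane)
    (hγ : ∀ i, DipolarEnergy.IsArcLengthJordanCurve (P i) (γ i))
    (hγ_disj : ∀ i j, i ≠ j → Disjoint (γ i '' Icc 0 (P i)) (γ j '' Icc 0 (P j)))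
    (hγ_frontier : frontier Ω = ⋃ i, γ i '' Icc 0 (P i))
    (hγ_orient : ∀ i, DipolarEnergy.IsPositivelyOriented Ω (γ i)) :
    (∀ i, IntegrableOn (fun p : ℝ × ℝ => DipolarEnergy.selfDensity (γ i) p.1 p.2)
      (Icc 0 (P i) ×ˢ Icc (-(P i / 2)) (P i / 2))) ∧
    (∀ i j, i ≠ j →
      IntegrableOn (fun p : ℝ × ℝ => DipolarEnergy.mutualDensity (γ i) (γ j) p.1 p.2)
        (Icc 0 (P i) ×ˢ Icc 0 (P j))) ∧
    DipolarEnergy.E10 Ω =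
      ((-(∑ i, P i * (Real.log (P i / 2) + 2))
        + (1 / 2) * (∑ i, ∫ t in (0 : ℝ)..(P i), (∫ s in (-(P i / 2))..(P i / 2),
            DipolarEnergy.selfDensity (γ i) t s))
        - (∑ i, ∑ j ∈ Finset.Ioi i, ∫ t in (0 : ℝ)..(P i), (∫ s in (0 : ℝ)..(P j),
            DipolarEnergy.mutualDensity (γ i) (γ j) t s)) : ℝ) : EReal) := by
  have h : DipolarEnergy.IsBoundedBy Ω P γ :=
    { nullMeasurable := hΩ_meas
      area := hΩ_area
      c2 := hΩ_C2
      curve := hγ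
      disjoint_range := fun i j hij => by
        rw [(hγ i).range_eq_image_Icc, (hγ j).range_eq_image_Icc]
        exact hγ_disj i j hij
      frontier_eq := by
        rw [hγ_frontier]
        exact iUnion_congr fun i => (hγ i).range_eq_image_Icc.symm
      oriented := hγ_orient }
  exact ⟨fun i => (hγ i).integrableOn_selfDensity, fun i j hij => h.integrableOn_mutualDensity hij,
    h.E10_eq⟩
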